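/- Let $\alpha\in[1,2)$ and let $\widetilde M_\alpha$ be a complex-valued rotationally invariant $\alpha$-stable random measure on $\mathbb R$ with Lebesgue control measure $\lambda$, on a probability space $(\Omega,\mathcal F,\mathbb P)$; that is, $\widetilde M_\alpha$ is an independently scattered, $\sigma$-additive (in the almost sure sense) random set function on the Borel sets $A$ with $\lambda(A)<\infty$ such that $\mathbb E\exp\big(i\,\mathrm{Re}(\overline z\,\widetilde M_\alpha(A))\big)=\exp\big(-c|z|^\alpha\lambda(A)\big)$ for all $z\in\mathbb C$, where $c>0$ is a normalizing constant. For $f\in L^\alpha(\mathbb R)$, the integral $\int_{\mathbb R} f\,d\widetilde M_\alpha$ is the limit in probability of the integrals of simple functions converging to $f$ in $L^\alpha(\mathbb R)$. Let $\psi$ be a real-valued Meyer mother wavelet, i.e. a real-valued function of the Schwartz class such that $\{2^{j/2}\psi(2^j\cdot-k):(j,k)\in\mathbb Z^2\}$ is an orthonormal basis of $L^2(\mathbb R)$ and such that its Fourier transform $\widehat\psi(\xi)=\int_{\mathbb R}e^{-i\xi x}\psi(x)\,dx$ is supported in $\{2\pi/3\le|\xi|\le 8\pi/3\}$. For $(j,k)\in\mathbb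 Z^2$ let $$\varepsilon_{\alpha,j,k}:=\int_{\mathbb R}2^{-j/\alpha}e^{ik2^{-j}\xi}\,\widehat\psi(-2^{-j}\xi)\,d\widetilde M_\alpha(\xi)$$ be the stable wavelet coefficients of the harmonizable fractional stable motion driven by $\widetilde M_\alpha$. Let $\delta>0$ and $\rho>0$. Then there exist an event $\Omega^*$ of probability $1$ and a positive finite random variable $C$ (depending on $\alpha$, $\delta$ and $\rho$) such that on $\Omega^*$ the inequality $$\big|\mathrm{Re}(\varepsilon_{\alpha,j,k})\big|\le C\,(1+j)^{1/\alpha+\delta}$$ holds for all integers $j\ge0$ and $k\in\mathbb Z$ satisfying $|2^{-j}k|\le\rho$. -/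

import Mathlib

open MeasureTheory ProbabilityTheory Filter Topology

noncomputable section

namespace HFSM

/-- A complex-valued rotationally invariant `α`-stable random measure on `ℝ` with Lebesgue control
measure, defined on the Borel sets of finite Lebesgue measure (the values of `M` on other sets play
no role). The constant `c > 0` is the normalization of the scale parameter:
`E exp (i Re (conj z * M A)) = exp (-c |z|^α λ(A))`; note that `charFun μ z = ∫ exp (i ⟪x, z⟫) dμ(x)`
and that `⟪x, z⟫ = Re (conj z * x)` for the real inner product of `ℂ`. -/
structure IsStableRandomMeasure {Ω : Type*} [MeasurableSpace Ω] (P : Measure Ω) (α c : ℝ)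
    (M : Set ℝ → Ω → ℂ) : Prop where
  /-- each `M A` is a random variable -/
  measurable : ∀ A : Set ℝ, MeasurableSet A → volume A < ⊤ → Measurable (M A)
  /-- each `M A` is isotropic (rotationally invariant) `α`-stable -/
  charFun_eq : ∀ A : Set ℝ, MeasurableSet A → volume A < ⊤ → ∀ z : ℂ,
    charFun (P.map (M A)) z = Complex.exp (-((c * ‖z‖ ^ α * (volume A).toReal : ℝ) : ℂ))
  /-- `M` is independently scattered -/
  indep : ∀ (ι : Type) [Fintype ι] (A : ι → Set ℝ), (∀ i, MeasurableSet (A i)) →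
    (∀ i, volume (A i) < ⊤) → Pairwise (Function.onFun Disjoint A) →
    iIndepFun (fun i => M (A i)) P
  /-- `M` is `σ`-additive: the series of the `M (A i)` converges almost surely to `M (⋃ i, A i)`
  (in general the convergence is not absolute) -/
  sigmaAdditive : ∀ A : ℕ → Set ℝ, (∀ i, MeasurableSet (A i)) → volume (⋃ i, A i) < ⊤ →
    Pairwise (Function.onFun Disjoint A) →
    ∀ᵐ ω ∂P, Tendsto (fun n => ∑ i ∈ Finset.range n, M (A i) ω) atTop (𝓝 (M (⋃ i, A i) ω))

/-- The stochastic integral `∑ y, y * M {s = y}` of a simple function `s`. -/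
def simpleIntegral {Ω : Type*} (M : Set ℝ → Ω → ℂ) (s : SimpleFunc ℝ ℂ) (ω : Ω) : ℂ :=
  ∑ y ∈ s.range, y * M (s ⁻¹' {y}) ω

/-- `Y` is (a version of) the stable stochastic integral `∫ f dM` of `f ∈ L^α(ℝ)`: the limit in
probability of the integrals of simple functions which converge to `f` in `L^α(ℝ)`. -/
def IsStableIntegral {Ω : Type*} [MeasurableSpace Ω] (P : Measure Ω) (α : ℝ)
    (M : Set ℝ → Ω → ℂ) (f : ℝ → ℂ) (Y : Ω → ℂ) : Prop :=
  Measurable Y ∧ MemLp f (ENNReal.ofReal α) volume ∧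
    ∃ s : ℕ → SimpleFunc ℝ ℂ, (∀ n, (s n).FinMeasSupp volume) ∧
      Tendsto (fun n => ∫⁻ ξ, ‖s n ξ - f ξ‖ₑ ^ α) atTop (𝓝 0) ∧
      TendstoInMeasure P (fun n => simpleIntegral M (s n)) atTop Y

/-- The Fourier transform with the convention `ψ̂(ξ) = ∫ exp(-i ξ x) ψ(x) dx`. -/
def hat (ψ : SchwartzMap ℝ ℝ) (ξ : ℝ) : ℂ :=
  ∫ x : ℝ, Complex.exp (-(Complex.I * ξ * x)) * (ψ x : ℂ)

/-- The dilated and translated wavelet `ψ_{j,k}(x) = 2^{j/2} ψ(2^j x - k)`. -/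
def wavelet (ψ : SchwartzMap ℝ ℝ) (j k : ℤ) (x : ℝ) : ℝ :=
  (2 : ℝ) ^ ((j : ℝ) / 2) * ψ ((2 : ℝ) ^ j * x - k)

/-- A real-valued univariate Meyer mother wavelet: a function `ψ` of the Schwartz class which
generates an orthonormal wavelet basis of `L²(ℝ)` and whose Fourier transform is supported in
`{2π/3 ≤ |ξ| ≤ 8π/3}`. -/
structure IsMeyerWavelet (ψ : SchwartzMap ℝ ℝ) : Prop where
  orthonormal : ∀ j k j' k' : ℤ,
    ∫ x : ℝ, wavelet ψ j k x * wavelet ψ j' k' x = if j = j' ∧ k = k' then 1 else 0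
  complete : ∀ f : ℝ → ℝ, MemLp f 2 volume →
    (∀ j k : ℤ, ∫ x : ℝ, f x * wavelet ψ j k x = 0) → f =ᵐ[volume] 0
  tsupport_hat : tsupport (hat ψ) ⊆ {ξ : ℝ | 2 * Real.pi / 3 ≤ |ξ| ∧ |ξ| ≤ 8 * Real.pi / 3}

/-- The integrand `2^{-j/α} exp(i k 2^{-j} ξ) ψ̂(-2^{-j} ξ)` whose stable integral is the wavelet
coefficient `ε_{α,j,k}`. -/
def kernel (α : ℝ) (ψ : SchwartzMap ℝ ℝ) (j k : ℤ) (ξ : ℝ) : ℂ :=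
  (((2 : ℝ) ^ (-(j : ℝ) / α) : ℝ) : ℂ) *
    Complex.exp (Complex.I * (((k : ℝ) * (2 : ℝ) ^ (-j) * ξ : ℝ) : ℂ)) *
      hat ψ (-((2 : ℝ) ^ (-j) * ξ))

end HFSM

end

/-! A union bound over the roughly `2 ^ j` translations fails if each coefficient is estimated by
its own power tail, so the proof exploits that all coefficients of scale `j` are integrals against
the same random measure. Their kernels are bounded by `2 ^ (-j/α) * H` and vanish for `|ξ| > 9 * 2 ^
j`. After discretization on one partition they become linear combinations, with coefficients of
modulus at most one, of the same independent isotropic stable variables, whose total weight `W = 18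
* c * H ^ α` does not depend on `j`.

These variables are split at two levels `τ < x` (`measureReal_exists_re_sum_gt_le`). That none
exceeds `x` is a single event, of complementary probability `O(x ^ (-α))`. The variables in `(τ, x]`
contribute at most the sum of their moduli, whatever the coefficients, and this sum has an
exponential tail. Only the variables of modulus at most `τ` depend on `k`: they are symmetric and
bounded, so an exponential tail pays for the union over `k`.

With `J = 1 + j`, `τ = J ^ (-1/α)` and `x = J ^ (1/α + δ/2)`, a threshold of order `J ^ (1/α + δ)`
is exceeded with summable probability, and Borel–Cantelli (`exists_random_bound`) gives the random
constant. The passage from simple functions to the integrals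
(`measureReal_exists_re_integral_gt_le`) costs only one more multiple of the threshold. -/

namespace HFSM

/-! ### Tails and truncated moments of isotropic stable laws. -/

/-- The isotropic `α`-stable law on `ℂ` with scale weight `w`, described by its characteristic
function. -/
def IsIsotropicStable (μ : Measure ℂ) (α w : ℝ) : Prop :=
  ∀ z : ℂ, charFun μ z = Complex.exp (-((w * ‖z‖ ^ α : ℝ) : ℂ))

theorem IsIsotropicStable.norm_one_sub_charFun_le {μ : Measure ℂ} {α w : ℝ}
    (h : IsIsotropicStable μ α w) (hw : 0 ≤ w) (z : ℂ) : ‖1 - charFun μ z‖ ≤ w * ‖z‖ ^ α := by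
  have h0 : 0 ≤ w * ‖z‖ ^ α := by positivity
  rw [h z, ← Complex.ofReal_neg, ← Complex.ofReal_exp, ← Complex.ofReal_one, ← Complex.ofReal_sub,
    Complex.norm_real, Real.norm_eq_abs, abs_of_nonneg]
  · linarith [Real.add_one_le_exp (-(w * ‖z‖ ^ α))]
  · linarith [Real.exp_le_one_iff.2 (neg_nonpos.2 h0)]

/-- The tail of a projection is controlled by the average of `1 - charFun` over the segment `|t| ≤ 2
/ r`, where it is at most `w * (2 / r) ^ α`. -/
theorem IsIsotropicStable.measureReal_abs_inner_gt_le {μ : Measure ℂ} [IsProbabilityMeasure μ]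
    {α w : ℝ} (h : IsIsotropicStable μ α w) (hw : 0 ≤ w) (hα : 0 ≤ α) {a : ℂ} (ha : ‖a‖ = 1)
    {r : ℝ} (hr : 0 < r) :
    μ.real {x | r < |inner ℝ a x|} ≤ 2 * w * (2 / r) ^ α := by
  refine (measureReal_abs_inner_gt_le_integral_charFun hr).trans ?_
  have key : ‖∫ t in -2 * r⁻¹..2 * r⁻¹, 1 - charFun μ (t • a)‖
      ≤ (w * (2 / r) ^ α) * |2 * r⁻¹ - -2 * r⁻¹| := by
    refine intervalIntegral.norm_integral_le_of_norm_le_const fun t ht => ?_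
    refine (h.norm_one_sub_charFun_le hw _).trans ?_
    rw [norm_smul, ha, mul_one]
    have hr' : (0 : ℝ) < r⁻¹ := inv_pos.2 hr
    rw [Set.uIoc_of_le (by linarith)] at ht
    gcongr
    rw [Real.norm_eq_abs, abs_le, div_eq_mul_inv]
    exact ⟨by linarith [ht.1], ht.2⟩
  have h2 : |2 * r⁻¹ - -2 * r⁻¹| = 4 * r⁻¹ := by
    rw [show 2 * r⁻¹ - -2 * r⁻¹ = 4 * r⁻¹ by ring]
    exact abs_of_pos (by positivity)
  rw [h2] at key
  calc 2⁻¹ * r * ‖∫ t in -2 * r⁻¹..2 * r⁻¹, 1 - charFun μ (t • a)‖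
      ≤ 2⁻¹ * r * ((w * (2 / r) ^ α) * (4 * r⁻¹)) := by gcongr
    _ = 2 * w * (2 / r) ^ α := by field_simp; ring

/-- Tail bound for isotropic stable laws. -/
theorem IsIsotropicStable.measureReal_norm_gt_le {μ : Measure ℂ} [IsProbabilityMeasure μ]
    {α w : ℝ} (h : IsIsotropicStable μ α w) (hw : 0 ≤ w) (hα : 0 ≤ α) (hα2 : α ≤ 2)
    {y : ℝ} (hy : 0 < y) :
    μ.real {x | y < ‖x‖} ≤ 64 * w * y ^ (-α) := by
  have hsub : {x : ℂ | y < ‖x‖} ⊆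
      {x | y / 2 < |inner ℝ (1 : ℂ) x|} ∪ {x | y / 2 < |inner ℝ Complex.I x|} := by
    intro x hx
    simp only [Set.mem_ofPred_eq, Set.mem_union, Complex.inner] at hx ⊢
    by_contra hcon
    push Not at hcon
    simp at hcon
    linarith [Complex.norm_le_abs_re_add_abs_im x, hcon.1, hcon.2]
  have h1 := h.measureReal_abs_inner_gt_le hw hα (a := 1) (by simp) (half_pos hy)
  have h2 := h.measureReal_abs_inner_gt_le hw hα (a := Complex.I) (by simp) (half_pos hy)
  -- The two coordinate tails give the factor 4, and `4 ^ α ≤ 16`; hence the constant 64.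
  have h3 : (2 / (y / 2)) ^ α ≤ 16 * y ^ (-α) := by
    rw [show 2 / (y / 2) = 4 * y⁻¹ by field_simp; norm_num, Real.mul_rpow (by norm_num)
      (by positivity), Real.inv_rpow hy.le, ← Real.rpow_neg hy.le]
    gcongr
    calc (4 : ℝ) ^ α ≤ 4 ^ (2 : ℝ) := Real.rpow_le_rpow_of_exponent_le (by norm_num) hα2
      _ = 16 := by norm_num
  calc μ.real {x | y < ‖x‖} ≤ _ := measureReal_mono hsub
    _ ≤ _ := measureReal_union_le _ _
    _ ≤ 2 * w * (2 / (y / 2)) ^ α + 2 * w * (2 / (y / 2)) ^ α := add_le_add h1 h2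
    _ = 4 * w * (2 / (y / 2)) ^ α := by ring
    _ ≤ 4 * w * (16 * y ^ (-α)) := by gcongr
    _ = 64 * w * y ^ (-α) := by ring

theorem IsIsotropicStable.integral_one_sub_cos_le {μ : Measure ℂ} [IsProbabilityMeasure μ]
    {α w : ℝ} (h : IsIsotropicStable μ α w) (hw : 0 ≤ w) (z : ℂ) :
    ∫ x, (1 - Real.cos (inner ℝ x z)) ∂μ ≤ w * ‖z‖ ^ α := by
  have hI : Integrable (fun x : ℂ => Complex.exp ((inner ℝ x z : ℝ) * Complex.I)) μ := by
    refine Integrable.of_bound (by fun_prop) 1 (ae_of_all _ fun x => ?_)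
    rw [Complex.norm_exp_ofReal_mul_I]
  have hre : ∫ x, Real.cos (inner ℝ x z) ∂μ = (charFun μ z).re := by
    rw [charFun_apply]
    have := integral_re hI
    simp only [RCLike.re_to_complex, Complex.exp_ofReal_mul_I_re] at this
    exact this
  have hcos : Integrable (fun x : ℂ => Real.cos (inner ℝ x z)) μ :=
    Integrable.of_bound (by fun_prop) 1 (ae_of_all _ fun x => Real.abs_cos_le_one _)
  rw [integral_sub (integrable_const _) hcos, hre]
  simp only [integral_const, probReal_univ, smul_eq_mul, mul_one]
  calc 1 - (charFun μ z).re = (1 - charFun μ z).re := by simp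
    _ ≤ ‖1 - charFun μ z‖ := Complex.re_le_norm _
    _ ≤ _ := h.norm_one_sub_charFun_le hw z

/-- Truncated second moment of an isotropic stable law. -/
theorem IsIsotropicStable.integral_truncated_sq_le {μ : Measure ℂ} [IsProbabilityMeasure μ]
    {α w : ℝ} (h : IsIsotropicStable μ α w) (hw : 0 ≤ w) {t : ℝ} (ht : 0 < t) :
    ∫ x, (if ‖x‖ ≤ t then (‖x‖ / t) ^ 2 else 0) ∂μ ≤ 64 * w * t ^ (-α) := by
  have hb : ∀ z : ℂ, Integrable (fun x : ℂ => 1 - Real.cos (inner ℝ x z)) μ := fun z =>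
    Integrable.of_bound (by fun_prop) 2 (ae_of_all _ fun x => by
      rw [Real.norm_eq_abs, abs_le]
      constructor <;> linarith [Real.cos_le_one (inner ℝ x z), Real.neg_one_le_cos (inner ℝ x z)])
  set z₁ : ℂ := ((t⁻¹ : ℝ) : ℂ)
  set z₂ : ℂ := ((t⁻¹ : ℝ) : ℂ) * Complex.I
  have hz₁ : ‖z₁‖ = t⁻¹ := by
    simp [z₁, Complex.norm_real, abs_of_pos ht]
  have hz₂ : ‖z₂‖ = t⁻¹ := by
    simp [z₂, Complex.norm_real, abs_of_pos ht]
  -- `z₁` and `z₂` pick out the rescaled real and imaginary parts; each square is compared with `1 -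
  -- cos`, which is at least `(2 / π ^ 2) * u ^ 2` for `|u| ≤ π`.
  have hpt : ∀ x : ℂ, (if ‖x‖ ≤ t then (‖x‖ / t) ^ 2 else 0) ≤
      Real.pi ^ 2 / 2 * ((1 - Real.cos (inner ℝ x z₁)) + (1 - Real.cos (inner ℝ x z₂))) := by
    intro x
    have hc : ∀ u : ℝ, 0 ≤ 1 - Real.cos u := fun u => by linarith [Real.cos_le_one u]
    split_ifs with hx
    · have i₁ : inner ℝ x z₁ = x.re / t := by
        simp [Complex.inner, z₁, div_eq_mul_inv, Complex.ofReal_inv]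
        field_simp
      have i₂ : inner ℝ x z₂ = x.im / t := by
        simp [Complex.inner, z₂, div_eq_mul_inv, Complex.ofReal_inv]
        field_simp
      have hpi := Real.pi_pos
      have hq : ∀ u : ℝ, |u| ≤ t →
          (u / t) ^ 2 ≤ Real.pi ^ 2 / 2 * (1 - Real.cos (u / t)) := by
        intro u hu
        have hu1 : |u / t| ≤ 1 := by
          rw [abs_div, abs_of_pos ht]
          exact (div_le_one ht).2 hu
        have := Real.cos_le_one_sub_mul_cos_sq (x := u / t) (by linarith [Real.pi_gt_three])
        have h2 : 2 / Real.pi ^ 2 * (u / t) ^ 2 ≤ 1 - Real.cos (u / t) := by linarith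
        calc (u / t) ^ 2 = Real.pi ^ 2 / 2 * (2 / Real.pi ^ 2 * (u / t) ^ 2) := by field_simp
          _ ≤ _ := by gcongr
      have e : (‖x‖ / t) ^ 2 = (x.re / t) ^ 2 + (x.im / t) ^ 2 := by
        rw [div_pow, Complex.sq_norm, Complex.normSq_apply]; ring
      rw [e, i₁, i₂, mul_add]
      exact add_le_add (hq _ ((Complex.abs_re_le_norm x).trans hx))
        (hq _ ((Complex.abs_im_le_norm x).trans hx))
    · have := hc (inner ℝ x z₁)
      have := hc (inner ℝ x z₂)
      positivity
  -- A crude bound, giving the same constant as in the tail estimate.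
  have hpi2 : Real.pi ^ 2 ≤ 64 := by nlinarith [Real.pi_le_four, Real.pi_pos]
  calc ∫ x, (if ‖x‖ ≤ t then (‖x‖ / t) ^ 2 else 0) ∂μ
      ≤ ∫ x, Real.pi ^ 2 / 2 * ((1 - Real.cos (inner ℝ x z₁)) + (1 - Real.cos (inner ℝ x z₂))) ∂μ :=
        integral_mono_of_nonneg (ae_of_all _ fun x => by dsimp only; split_ifs <;> positivity)
          (((hb z₁).add (hb z₂)).const_mul _) (ae_of_all _ hpt)
    _ = Real.pi ^ 2 / 2 * (∫ x, (1 - Real.cos (inner ℝ x z₁)) ∂μ +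
          ∫ x, (1 - Real.cos (inner ℝ x z₂)) ∂μ) := by
        rw [integral_const_mul, integral_add (hb z₁) (hb z₂)]
    _ ≤ Real.pi ^ 2 / 2 * (w * t⁻¹ ^ α + w * t⁻¹ ^ α) := by
        have a₁ := h.integral_one_sub_cos_le hw z₁
        have a₂ := h.integral_one_sub_cos_le hw z₂
        rw [hz₁] at a₁
        rw [hz₂] at a₂
        gcongr
    _ = Real.pi ^ 2 * (w * t ^ (-α)) := by
        rw [Real.inv_rpow ht.le, ← Real.rpow_neg ht.le]; ring
    _ ≤ 64 * (w * t ^ (-α)) := by gcongr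
    _ = _ := by ring

/-- The characteristic function depends only on `‖z‖`. -/
theorem IsIsotropicStable.map_neg_eq {μ : Measure ℂ} [IsProbabilityMeasure μ] {α w : ℝ}
    (h : IsIsotropicStable μ α w) : μ.map (fun x => -x) = μ := by
  have : IsProbabilityMeasure (μ.map (fun x => -x)) :=
    Measure.isProbabilityMeasure_map (by fun_prop)
  refine Measure.ext_of_charFun (funext fun z => ?_)
  have := charFun_map_smul (μ := μ) (-1 : ℝ) z
  simp only [neg_smul, one_smul] at this
  rw [this, h, h, norm_neg]

/-- Odd functions have zero mean under an isotropic stable law. -/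
theorem IsIsotropicStable.integral_odd_eq_zero {μ : Measure ℂ} [IsProbabilityMeasure μ] {α w : ℝ}
    (h : IsIsotropicStable μ α w) {g : ℂ → ℝ} (hg : Measurable g) (hodd : ∀ x, g (-x) = -g x) :
    ∫ x, g x ∂μ = 0 := by
  have h1 : ∫ x, g x ∂μ = ∫ x, g (-x) ∂μ := by
    conv_lhs => rw [← h.map_neg_eq]
    rw [integral_map (by fun_prop) hg.aestronglyMeasurable]
  simp only [hodd, integral_neg] at h1
  linarith

/-- Multiplying an isotropic stable variable by `a` multiplies its weight by `‖a‖ ^ α`. -/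
theorem IsIsotropicStable.map_const_mul {Ω : Type*} [MeasurableSpace Ω] {P : Measure Ω} {X : Ω → ℂ}
    (hX : Measurable X) {α w : ℝ} (h : IsIsotropicStable (P.map X) α w) (a : ℂ) :
    IsIsotropicStable (P.map fun ω => a * X ω) α (‖a‖ ^ α * w) := by
  intro z
  have h1 : charFun (P.map fun ω => a * X ω) z = charFun (P.map X) (star a * z) := by
    rw [charFun_apply, charFun_apply, integral_map (by fun_prop) (by fun_prop),
      integral_map (by fun_prop) (by fun_prop)]
    refine integral_congr_ae (ae_of_all _ fun ω => ?_)
    have : inner ℝ (a * X ω) z = inner ℝ (X ω) (star a * z) := by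
      simp [Complex.inner]; ring
    simp only [this]
  rw [h1, h]
  congr 3
  rw [norm_mul, norm_star, Real.mul_rpow (norm_nonneg _) (norm_nonneg _)]
  ring

/-! ### Exponential bounds and truncation at two levels. -/

/-- Exponential tail bound for a sum of independent variables bounded by one. -/
theorem measureReal_sum_ge_le_exp {Ω : Type*} [MeasurableSpace Ω] {P : Measure Ω}
    [IsProbabilityMeasure P] {ι : Type*} [Fintype ι] {Z : ι → Ω → ℝ} (hZ : ∀ i, Measurable (Z i))
    (hind : iIndepFun Z P) (hb : ∀ i ω, |Z i ω| ≤ 1) {v : ι → ℝ}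
    (hv : ∀ i, ∫ ω, (Z i ω + Z i ω ^ 2) ∂P ≤ v i) (t : ℝ) :
    P.real {ω | t ≤ ∑ i, Z i ω} ≤ Real.exp (∑ i, v i - t) := by
  have hmgf : ∀ i, mgf (Z i) P 1 ≤ Real.exp (v i) := by
    intro i
    have hint : Integrable (fun ω => Z i ω + Z i ω ^ 2) P := by
      refine Integrable.of_bound (by fun_prop) 2 (ae_of_all _ fun ω => ?_)
      have := hb i ω
      rw [Real.norm_eq_abs]
      refine (abs_add_le _ _).trans ?_
      rw [abs_pow]
      nlinarith [abs_nonneg (Z i ω)]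
    calc mgf (Z i) P 1 = ∫ ω, Real.exp (Z i ω) ∂P := by simp [mgf]
      _ ≤ ∫ ω, (1 + (Z i ω + Z i ω ^ 2)) ∂P := by
          refine integral_mono_of_nonneg (ae_of_all _ fun ω => (Real.exp_pos _).le)
            ((integrable_const _).add hint) (ae_of_all _ fun ω => ?_)
          -- For `|z| ≤ 1`, `exp z ≤ 1 + z + z ^ 2`; this is why `hv` bounds the mean of `Z + Z ^
          -- 2`.
          have := (abs_le.1 (Real.abs_exp_sub_one_sub_id_le (hb i ω))).2
          dsimp only
          linarith
      _ = 1 + ∫ ω, (Z i ω + Z i ω ^ 2) ∂P := by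
          rw [integral_add (integrable_const _) hint]; simp
      _ ≤ v i + 1 := by linarith [hv i]
      _ ≤ Real.exp (v i) := Real.add_one_le_exp _
  have hsum : mgf (∑ i, Z i) P 1 ≤ Real.exp (∑ i, v i) := by
    rw [hind.mgf_sum hZ, Real.exp_sum]
    exact Finset.prod_le_prod (fun i _ => mgf_nonneg) fun i _ => hmgf i
  have hint : Integrable (fun ω => Real.exp (1 * (∑ i, Z i) ω)) P := by
    refine Integrable.of_bound (by fun_prop) (Real.exp (Fintype.card ι)) (ae_of_all _ fun ω => ?_)
    rw [Real.norm_eq_abs, Real.abs_exp, one_mul, Finset.sum_apply, Real.exp_le_exp]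
    calc ∑ i, Z i ω ≤ ∑ _i : ι, (1 : ℝ) :=
          Finset.sum_le_sum fun i _ => (le_abs_self _).trans (hb i ω)
      _ = Fintype.card ι := by simp
  have := measure_ge_le_exp_mul_mgf (X := ∑ i, Z i) (μ := P) t zero_le_one hint
  simp only [Finset.sum_apply] at this
  refine this.trans ?_
  calc Real.exp (-1 * t) * mgf (∑ i, Z i) P 1 ≤ Real.exp (-1 * t) * Real.exp (∑ i, v i) := by
        gcongr
    _ = _ := by rw [← Real.exp_add]; congr 1; ring

/-- The part of `z` with modulus at most `τ`. -/
noncomputable def smallPart (τ : ℝ) (z : ℂ) : ℂ := if ‖z‖ ≤ τ then z else 0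

/-- The modulus of `z` if it lies in `(τ, x]`, and zero otherwise. -/
noncomputable def midNorm (τ x : ℝ) (z : ℂ) : ℝ := if τ < ‖z‖ ∧ ‖z‖ ≤ x then ‖z‖ else 0

theorem measurable_smallPart (τ : ℝ) : Measurable (smallPart τ) :=
  Measurable.ite (measurableSet_le measurable_norm measurable_const) measurable_id measurable_const

theorem measurable_midNorm (τ x : ℝ) : Measurable (midNorm τ x) :=
  Measurable.ite ((measurableSet_lt measurable_const measurable_norm).inter
    (measurableSet_le measurable_norm measurable_const)) measurable_norm measurable_const

theorem norm_smallPart_le {τ : ℝ} (hτ : 0 ≤ τ) (z : ℂ) : ‖smallPart τ z‖ ≤ τ := by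
  unfold smallPart; split_ifs with h
  · exact h
  · simpa

theorem midNorm_nonneg (τ x : ℝ) (z : ℂ) : 0 ≤ midNorm τ x z := by
  unfold midNorm; split_ifs <;> simp

theorem midNorm_le {τ x : ℝ} (hx : 0 ≤ x) (z : ℂ) : midNorm τ x z ≤ x := by
  unfold midNorm; split_ifs with h
  · exact h.2
  · exact hx

theorem norm_sub_smallPart_le {τ x : ℝ} {z : ℂ} (hz : ‖z‖ ≤ x) :
    ‖z - smallPart τ z‖ ≤ midNorm τ x z := by
  unfold smallPart midNorm
  by_cases h : ‖z‖ ≤ τ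
  · simp [h, not_lt.2 h]
  · simp [h, not_le.1 h, hz]

/-- On `τ < ‖z‖ ≤ x` the ratio `q = ‖z‖ / x` satisfies `q ≤ J * q ^ 2 + 1 / J`. The first term is a
truncated second moment and the second a tail, so no first moment is needed and `α = 1` is not
special. -/
theorem IsIsotropicStable.integral_midNorm_le {μ : Measure ℂ} [IsProbabilityMeasure μ]
    {α w : ℝ} (h : IsIsotropicStable μ α w) (hw : 0 ≤ w) (hα : 0 ≤ α) (hα2 : α ≤ 2)
    {τ x J : ℝ} (hτ : 0 < τ) (hx : 0 < x) (hJ : 0 < J) :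
    ∫ z, midNorm τ x z / x ∂μ ≤ 64 * w * (J * x ^ (-α) + τ ^ (-α) / J) := by
  have i1 : Integrable (fun z : ℂ => if ‖z‖ ≤ x then (‖z‖ / x) ^ 2 else 0) μ := by
    refine Integrable.of_bound (Measurable.ite
      (measurableSet_le measurable_norm measurable_const) (by fun_prop)
      measurable_const).aestronglyMeasurable 1 (ae_of_all _ fun z => ?_)
    split_ifs with hz
    · rw [Real.norm_eq_abs, abs_of_nonneg (by positivity)]
      exact pow_le_one₀ (by positivity) ((div_le_one hx).2 hz)
    · simp
  have hm : MeasurableSet {z : ℂ | τ < ‖z‖} := measurableSet_lt measurable_const measurable_norm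
  have i2 : Integrable (Set.indicator {z : ℂ | τ < ‖z‖} fun _ => (1 : ℝ)) μ :=
    (integrable_const _).indicator hm
  have hpt : ∀ z : ℂ, midNorm τ x z / x ≤ J * (if ‖z‖ ≤ x then (‖z‖ / x) ^ 2 else 0) +
      J⁻¹ * Set.indicator {z : ℂ | τ < ‖z‖} (fun _ => (1 : ℝ)) z := by
    intro z
    unfold midNorm
    by_cases h1 : τ < ‖z‖ ∧ ‖z‖ ≤ x
    · have h2 : z ∈ {z : ℂ | τ < ‖z‖} := h1.1
      rw [if_pos h1, if_pos h1.2, Set.indicator_of_mem h2]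
      set q := ‖z‖ / x
      have hq : 0 ≤ q := by positivity
      have : J * q ^ 2 + J⁻¹ * 1 - q = J⁻¹ * ((J * q - 1 / 2) ^ 2 + 3 / 4) := by
        field_simp; ring
      have h3 : 0 ≤ J⁻¹ * ((J * q - 1 / 2) ^ 2 + 3 / 4) := by positivity
      linarith
    · rw [if_neg h1, zero_div]
      have : 0 ≤ Set.indicator {z : ℂ | τ < ‖z‖} (fun _ => (1 : ℝ)) z :=
        Set.indicator_nonneg (fun _ _ => zero_le_one) _
      have : (0 : ℝ) ≤ if ‖z‖ ≤ x then (‖z‖ / x) ^ 2 else 0 := by split_ifs <;> positivity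
      positivity
  calc ∫ z, midNorm τ x z / x ∂μ ≤ _ := integral_mono_of_nonneg
        (ae_of_all _ fun z => div_nonneg (midNorm_nonneg _ _ _) hx.le)
        ((i1.const_mul J).add (i2.const_mul J⁻¹)) (ae_of_all _ hpt)
    _ = J * ∫ z, (if ‖z‖ ≤ x then (‖z‖ / x) ^ 2 else 0) ∂μ + J⁻¹ * μ.real {z | τ < ‖z‖} := by
        rw [integral_add' (i1.const_mul J) (i2.const_mul J⁻¹), integral_const_mul,
          integral_const_mul, integral_indicator_const _ hm]
        simp
    _ ≤ J * (64 * w * x ^ (-α)) + J⁻¹ * (64 * w * τ ^ (-α)) := by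
        gcongr
        · exact h.integral_truncated_sq_le hw hx
        · exact h.measureReal_norm_gt_le hw hα hα2 hτ
    _ = _ := by ring

/-! ### Maximal inequality for sums of independent stable variables. -/

section Maximal

variable {Ω : Type*} [MeasurableSpace Ω] {P : Measure Ω} [IsProbabilityMeasure P]
  {ι : Type*} [Fintype ι] {X : ι → Ω → ℂ} {α : ℝ} {w : ι → ℝ} {W : ℝ}

theorem measureReal_exists_norm_gt_le (hX : ∀ i, Measurable (X i))
    (hst : ∀ i, IsIsotropicStable (P.map (X i)) α (w i)) (hw : ∀ i, 0 ≤ w i) (hW : ∑ i, w i ≤ W)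
    (hα : 0 ≤ α) (hα2 : α ≤ 2) {x : ℝ} (hx : 0 < x) :
    P.real {ω | ∃ i, x < ‖X i ω‖} ≤ 64 * W * x ^ (-α) := by
  have hset : {ω | ∃ i, x < ‖X i ω‖} = ⋃ i, {ω | x < ‖X i ω‖} := by ext; simp
  calc P.real {ω | ∃ i, x < ‖X i ω‖} ≤ ∑ i, P.real {ω | x < ‖X i ω‖} := by
        rw [hset]; exact measureReal_iUnion_fintype_le _
    _ ≤ ∑ i, 64 * w i * x ^ (-α) := by
        refine Finset.sum_le_sum fun i _ => ?_
        have := Measure.isProbabilityMeasure_map (μ := P) (hX i).aemeasurable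
        have h := (hst i).measureReal_norm_gt_le (hw i) hα hα2 hx
        rwa [map_measureReal_apply (hX i) (measurableSet_lt measurable_const measurable_norm)] at h
    _ = 64 * (∑ i, w i) * x ^ (-α) := by
        rw [Finset.mul_sum, Finset.sum_mul]
    _ ≤ _ := by gcongr

/-- The summands lie in `[0, 1]`, so `Z + Z ^ 2 ≤ 2 * Z`, which doubles 64 to 128. -/
theorem measureReal_sum_midNorm_ge_le (hX : ∀ i, Measurable (X i)) (hind : iIndepFun X P)
    (hst : ∀ i, IsIsotropicStable (P.map (X i)) α (w i)) (hw : ∀ i, 0 ≤ w i) (hW : ∑ i, w i ≤ W)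
    (hα : 0 ≤ α) (hα2 : α ≤ 2) {τ x J : ℝ} (hτ : 0 < τ) (hx : 0 < x) (hJ : 0 < J) (u : ℝ) :
    P.real {ω | u ≤ ∑ i, midNorm τ x (X i ω) / x} ≤
      Real.exp (128 * W * (J * x ^ (-α) + τ ^ (-α) / J) - u) := by
  have hg : Measurable fun z => midNorm τ x z / x := (measurable_midNorm τ x).div_const x
  have hg0 : ∀ z, 0 ≤ midNorm τ x z / x := fun z => div_nonneg (midNorm_nonneg _ _ _) hx.le
  have hg1 : ∀ z, midNorm τ x z / x ≤ 1 := fun z => (div_le_one hx).2 (midNorm_le hx.le z)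
  refine (measureReal_sum_ge_le_exp (Z := fun i ω => midNorm τ x (X i ω) / x)
    (v := fun i => 128 * w i * (J * x ^ (-α) + τ ^ (-α) / J)) (fun i => hg.comp (hX i))
    (hind.comp _ fun _ => hg) (fun i ω => ?_) (fun i => ?_) u).trans ?_
  · rw [abs_of_nonneg (hg0 _)]; exact hg1 _
  · have := Measure.isProbabilityMeasure_map (μ := P) (hX i).aemeasurable
    have h := (hst i).integral_midNorm_le (hw i) hα hα2 hτ hx hJ
    rw [integral_map (hX i).aemeasurable hg.aestronglyMeasurable] at h
    have hi : Integrable (fun ω => 2 * (midNorm τ x (X i ω) / x)) P := by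
      refine (Integrable.of_bound (hg.comp (hX i)).aestronglyMeasurable 1
        (ae_of_all _ fun ω => ?_)).const_mul 2
      rw [Real.norm_eq_abs, Function.comp, abs_of_nonneg (hg0 _)]; exact hg1 _
    calc _ ≤ ∫ ω, 2 * (midNorm τ x (X i ω) / x) ∂P := by
          refine integral_mono_of_nonneg (ae_of_all _ fun ω => ?_) hi (ae_of_all _ fun ω => ?_)
          · have := hg0 (X i ω)
            dsimp only; positivity
          · dsimp only
            nlinarith [hg0 (X i ω), hg1 (X i ω)]
      _ ≤ 2 * (64 * w i * (J * x ^ (-α) + τ ^ (-α) / J)) := by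
          rw [integral_const_mul]; gcongr
      _ = _ := by ring
  · rw [← Finset.sum_mul, ← Finset.mul_sum]
    gcongr

/-- Symmetry removes the mean, so only the truncated second moment enters the exponent. -/
theorem measureReal_re_sum_smallPart_ge_le (hX : ∀ i, Measurable (X i)) (hind : iIndepFun X P)
    (hst : ∀ i, IsIsotropicStable (P.map (X i)) α (w i)) (hw : ∀ i, 0 ≤ w i) (hW : ∑ i, w i ≤ W)
    {τ : ℝ} (hτ : 0 < τ) {a : ι → ℂ} (ha : ∀ i, ‖a i‖ ≤ 1) (t : ℝ) :
    P.real {ω | t ≤ ∑ i, (a i * smallPart τ (X i ω)).re / τ} ≤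
      Real.exp (64 * W * τ ^ (-α) - t) := by
  have hg : ∀ i, Measurable fun z => (a i * smallPart τ z).re / τ := fun i =>
    (Complex.measurable_re.comp ((measurable_smallPart τ).const_mul (a i))).div_const τ
  have hle : ∀ i z, |(a i * smallPart τ z).re / τ| ≤ ‖smallPart τ z‖ / τ := fun i z => by
    rw [abs_div, abs_of_pos hτ]
    gcongr
    refine (Complex.abs_re_le_norm _).trans ?_
    rw [norm_mul]
    exact mul_le_of_le_one_left (norm_nonneg _) (ha i)
  have hle1 : ∀ i z, |(a i * smallPart τ z).re / τ| ≤ 1 := fun i z =>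
    (hle i z).trans ((div_le_one hτ).2 (norm_smallPart_le hτ.le z))
  refine (measureReal_sum_ge_le_exp (Z := fun i ω => (a i * smallPart τ (X i ω)).re / τ)
    (v := fun i => 64 * w i * τ ^ (-α)) (fun i => (hg i).comp (hX i))
    (hind.comp _ hg) (fun i ω => hle1 i _) (fun i => ?_) t).trans ?_
  · have := Measure.isProbabilityMeasure_map (μ := P) (hX i).aemeasurable
    have h0 : ∫ z, (a i * smallPart τ z).re / τ ∂(P.map (X i)) = 0 :=
      (hst i).integral_odd_eq_zero (hg i) fun z => by
        unfold smallPart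
        rw [norm_neg]
        split_ifs <;> simp
        ring
    have h2 := (hst i).integral_truncated_sq_le (hw i) hτ
    have i1 : Integrable (fun z => (a i * smallPart τ z).re / τ) (P.map (X i)) :=
      Integrable.of_bound (hg i).aestronglyMeasurable 1 (ae_of_all _ fun z => hle1 i z)
    have i2 : Integrable (fun z => ((a i * smallPart τ z).re / τ) ^ 2) (P.map (X i)) :=
      Integrable.of_bound ((hg i).pow_const 2).aestronglyMeasurable 1 (ae_of_all _ fun z => by
        rw [norm_pow, Real.norm_eq_abs]
        exact pow_le_one₀ (abs_nonneg _) (hle1 i z))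
    have i3 : Integrable (fun z : ℂ => if ‖z‖ ≤ τ then (‖z‖ / τ) ^ 2 else 0) (P.map (X i)) := by
      refine Integrable.of_bound (Measurable.ite
        (measurableSet_le measurable_norm measurable_const) (by fun_prop)
        measurable_const).aestronglyMeasurable 1 (ae_of_all _ fun z => ?_)
      split_ifs with hz
      · rw [Real.norm_eq_abs, abs_of_nonneg (by positivity)]
        exact pow_le_one₀ (by positivity) ((div_le_one hτ).2 hz)
      · simp
    calc _ = ∫ z, ((a i * smallPart τ z).re / τ + ((a i * smallPart τ z).re / τ) ^ 2)
            ∂(P.map (X i)) := by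
          have := integral_map (hX i).aemeasurable
            ((hg i).add ((hg i).pow_const 2)).aestronglyMeasurable (μ := P)
          exact this.symm
      _ = ∫ z, ((a i * smallPart τ z).re / τ) ^ 2 ∂(P.map (X i)) := by
          rw [integral_add i1 i2, h0, zero_add]
      _ ≤ ∫ z, (if ‖z‖ ≤ τ then (‖z‖ / τ) ^ 2 else 0) ∂(P.map (X i)) := by
          refine integral_mono i2 i3 fun z => ?_
          have h := pow_le_pow_left₀ (abs_nonneg _) (hle i z) 2
          rw [sq_abs] at h
          refine h.trans (le_of_eq ?_)
          unfold smallPart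
          split_ifs <;> simp
      _ ≤ _ := h2
  · rw [← Finset.sum_mul, ← Finset.mul_sum]
    gcongr

/-- Maximal inequality for finitely many linear combinations, with coefficients bounded by one, of
independent isotropic stable variables: the variables are split at the levels `τ` and `x`. -/
theorem measureReal_exists_re_sum_gt_le (hX : ∀ i, Measurable (X i)) (hind : iIndepFun X P)
    (hst : ∀ i, IsIsotropicStable (P.map (X i)) α (w i)) (hw : ∀ i, 0 ≤ w i) (hW : ∑ i, w i ≤ W)
    (hα : 0 ≤ α) (hα2 : α ≤ 2) {τ x J : ℝ} (hτ : 0 < τ) (hx : 0 < x) (hJ : 0 < J) (t u : ℝ)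
    {κ : Type*} (S : Finset κ) {a : κ → ι → ℂ} (ha : ∀ k i, ‖a k i‖ ≤ 1) :
    P.real {ω | ∃ k ∈ S, t * τ + u * x < |(∑ i, a k i * X i ω).re|} ≤
      64 * W * x ^ (-α) + Real.exp (128 * W * (J * x ^ (-α) + τ ^ (-α) / J) - u) +
        S.card * (2 * Real.exp (64 * W * τ ^ (-α) - t)) := by
  -- `E₁` and `E₂` do not involve `k`; only the upper and lower tails `E₃ k` and `E₄ k` are
  -- multiplied by the cardinality of `S`.
  set E₁ : Set Ω := {ω | ∃ i, x < ‖X i ω‖}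
  set E₂ : Set Ω := {ω | u ≤ ∑ i, midNorm τ x (X i ω) / x}
  set E₃ : κ → Set Ω := fun k => {ω | t ≤ ∑ i, (a k i * smallPart τ (X i ω)).re / τ}
  set E₄ : κ → Set Ω := fun k => {ω | t ≤ ∑ i, (-a k i * smallPart τ (X i ω)).re / τ}
  have hsub : {ω | ∃ k ∈ S, t * τ + u * x < |(∑ i, a k i * X i ω).re|} ⊆
      (E₁ ∪ E₂) ∪ ⋃ k ∈ S, (E₃ k ∪ E₄ k) := by
    rintro ω ⟨k, hk, hlt⟩
    by_contra hcon
    simp only [Set.mem_union, not_or, Set.mem_iUnion, not_exists] at hcon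
    obtain ⟨⟨h1, h2⟩, h3⟩ := hcon
    have h34 := h3 k hk
    simp only [E₁, E₂, E₃, E₄, Set.mem_ofPred_eq, not_exists, not_lt, not_le, neg_mul,
      Complex.neg_re, neg_div, Finset.sum_neg_distrib] at h1 h2 h34
    rw [← Finset.sum_div, div_lt_iff₀ hx] at h2
    rw [← Finset.sum_div, div_lt_iff₀ hτ, neg_lt, lt_div_iff₀ hτ] at h34
    have hsplit : (∑ i, a k i * X i ω).re = ∑ i, (a k i * smallPart τ (X i ω)).re +
        ∑ i, (a k i * (X i ω - smallPart τ (X i ω))).re := by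
      rw [← Finset.sum_add_distrib, Complex.re_sum]
      refine Finset.sum_congr rfl fun i _ => ?_
      rw [← Complex.add_re]; congr 1; ring
    have hA : |∑ i, (a k i * smallPart τ (X i ω)).re| < t * τ :=
      abs_lt.2 ⟨by linarith [h34.2], h34.1⟩
    have hB : |∑ i, (a k i * (X i ω - smallPart τ (X i ω))).re| ≤ ∑ i, midNorm τ x (X i ω) := by
      refine (Finset.abs_sum_le_sum_abs _ _).trans (Finset.sum_le_sum fun i _ => ?_)
      refine (Complex.abs_re_le_norm _).trans ?_
      rw [norm_mul]
      exact (mul_le_of_le_one_left (norm_nonneg _) (ha k i)).trans (norm_sub_smallPart_le (h1 i))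
    rw [hsplit] at hlt
    linarith [abs_add_le (∑ i, (a k i * smallPart τ (X i ω)).re)
      (∑ i, (a k i * (X i ω - smallPart τ (X i ω))).re)]
  calc _ ≤ P.real ((E₁ ∪ E₂) ∪ ⋃ k ∈ S, (E₃ k ∪ E₄ k)) := measureReal_mono hsub
    _ ≤ (P.real E₁ + P.real E₂) + ∑ k ∈ S, P.real (E₃ k ∪ E₄ k) :=
        (measureReal_union_le _ _).trans
          (add_le_add (measureReal_union_le _ _) (measureReal_biUnion_finset_le _ _))
    _ ≤ _ := by
        refine add_le_add (add_le_add
          (measureReal_exists_norm_gt_le hX hst hw hW hα hα2 hx)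
          (measureReal_sum_midNorm_ge_le hX hind hst hw hW hα hα2 hτ hx hJ u)) ?_
        rw [← nsmul_eq_mul]
        refine Finset.sum_le_card_nsmul _ _ _ fun k _ => (measureReal_union_le _ _).trans ?_
        rw [two_mul]
        exact add_le_add
          (measureReal_re_sum_smallPart_ge_le hX hind hst hw hW hτ (ha k) t)
          (measureReal_re_sum_smallPart_ge_le hX hind hst hw hW hτ
            (fun i => by rw [norm_neg]; exact ha k i) t)

end Maximal

/-! ### Stable integrals of simple functions and their limits. -/

section RandomMeasure

variable {Ω : Type*} [MeasurableSpace Ω] {P : Measure Ω} {α c : ℝ} {M : Set ℝ → Ω → ℂ}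

/-- For the constant sequence `∅` the partial sums converge, so their increments `M ∅` tend to zero.
-/
theorem IsStableRandomMeasure.empty_ae_eq_zero (hM : IsStableRandomMeasure P α c M) :
    ∀ᵐ ω ∂P, M ∅ ω = 0 := by
  have h := hM.sigmaAdditive (fun _ => ∅) (fun _ => MeasurableSet.empty) (by simp)
    (fun i j _ => by simp [Function.onFun])
  filter_upwards [h] with ω hω
  have h2 := ((tendsto_add_atTop_iff_nat 1).2 hω).sub hω
  simp only [Finset.sum_range_succ, add_sub_cancel_left, sub_self] at h2
  exact tendsto_nhds_unique tendsto_const_nhds h2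

theorem IsStableRandomMeasure.union_ae_eq (hM : IsStableRandomMeasure P α c M) {S T : Set ℝ}
    (hS : MeasurableSet S) (hT : MeasurableSet T) (hSfin : volume S < ⊤) (hTfin : volume T < ⊤)
    (hd : Disjoint S T) : ∀ᵐ ω ∂P, M (S ∪ T) ω = M S ω + M T ω := by
  let A : ℕ → Set ℝ := fun n => if n = 0 then S else if n = 1 then T else ∅
  have hA : ⋃ i, A i = S ∪ T := by
    ext ξ
    simp only [Set.mem_iUnion, Set.mem_union, A]
    constructor
    · rintro ⟨i, hi⟩
      split_ifs at hi
      · exact Or.inl hi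
      · exact Or.inr hi
      · exact hi.elim
    · rintro (h | h)
      · exact ⟨0, by simpa⟩
      · exact ⟨1, by simpa⟩
  have h := hM.sigmaAdditive A (fun i => by dsimp only [A]; split_ifs <;> simp [hS, hT])
    (by rw [hA]; exact (measure_union_le _ _).trans_lt (ENNReal.add_lt_top.2 ⟨hSfin, hTfin⟩))
    (fun i j hij => by
      simp only [Function.onFun, A]
      split_ifs <;> first | omega | simp [hd.symm])
  filter_upwards [h, hM.empty_ae_eq_zero] with ω hω h0
  rw [hA] at hω
  have h2 := (tendsto_add_atTop_iff_nat 2).2 hω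
  have h3 : ∀ n, ∑ i ∈ Finset.range (n + 2), M (A i) ω = M S ω + M T ω := fun n => by
    rw [Finset.sum_range_succ', Finset.sum_range_succ', Finset.sum_eq_zero]
    · simp [A, add_comm]
    · intro i _
      simp [A, h0]
  simp only [h3] at h2
  exact tendsto_nhds_unique h2 tendsto_const_nhds

theorem IsStableRandomMeasure.biUnion_ae_eq (hM : IsStableRandomMeasure P α c M) {β : Type*}
    (s : Finset β) {A : β → Set ℝ} (hA : ∀ b, MeasurableSet (A b))
    (hfin : ∀ b ∈ s, volume (A b) < ⊤) (hd : Pairwise (Function.onFun Disjoint A)) :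
    ∀ᵐ ω ∂P, M (⋃ b ∈ s, A b) ω = ∑ b ∈ s, M (A b) ω := by
  classical
  induction s using Finset.induction_on with
  | empty => simpa using hM.empty_ae_eq_zero
  | insert a s ha ih =>
    have h1 := ih fun b hb => hfin b (Finset.mem_insert_of_mem hb)
    have h2 := hM.union_ae_eq (hA a) (s.measurableSet_biUnion fun b _ => hA b)
      (hfin a (Finset.mem_insert_self _ _))
      ((measure_biUnion_lt_top s.finite_toSet fun b hb =>
        hfin b (Finset.mem_insert_of_mem hb)))
      (Set.disjoint_iUnion₂_right.2 fun b hb => hd fun hab => ha (hab ▸ hb))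
    filter_upwards [h1, h2] with ω e1 e2
    rw [Finset.set_biUnion_insert, Finset.sum_insert ha, e2, e1]

/-- The integral of a simple function can be computed on a finer partition. -/
theorem IsStableRandomMeasure.simpleIntegral_map_ae_eq (hM : IsStableRandomMeasure P α c M)
    {β : Type*} (p : SimpleFunc ℝ β) (g : β → ℂ)
    (hfin : ∀ b ∈ p.range, g b ≠ 0 → volume (p ⁻¹' {b}) < ⊤) :
    ∀ᵐ ω ∂P, simpleIntegral M (p.map g) ω = ∑ b ∈ p.range, g b * M (p ⁻¹' {b}) ω := by
  classical
  -- The value `y = 0` is left out: its fiber may have infinite measure, and it contributes nothing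
  -- to the integral.
  have key : ∀ y ∈ (p.map g).range, ∀ᵐ ω ∂P, y ≠ 0 →
      M (p.map g ⁻¹' {y}) ω = ∑ b ∈ p.range with g b = y, M (p ⁻¹' {b}) ω := by
    intro y _
    by_cases hy : y = 0
    · exact ae_of_all _ fun ω h => (h hy).elim
    have h := hM.biUnion_ae_eq {b ∈ p.range | g b = y} (A := fun b => p ⁻¹' {b})
      (fun b => p.measurableSet_fiber b)
      (fun b hb => by
        rw [Finset.mem_filter] at hb
        exact hfin b hb.1 (hb.2 ▸ hy))
      (fun b b' hb => Disjoint.preimage p (by simpa using hb))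
    filter_upwards [h] with ω hω _
    rw [SimpleFunc.map_preimage_singleton, ← Finset.set_biUnion_preimage_singleton]
    exact hω
  filter_upwards [(Finset.eventually_all _).2 key] with ω hω
  unfold simpleIntegral
  rw [SimpleFunc.range_map] at hω ⊢
  refine Finset.sum_image' _ fun b hb => ?_
  by_cases h0 : g b = 0
  · rw [h0, zero_mul, Finset.sum_eq_zero]
    intro b' hb'
    rw [(Finset.mem_filter.1 hb').2, zero_mul]
  · rw [hω _ (Finset.mem_image_of_mem g hb) h0, Finset.mul_sum]
    refine Finset.sum_congr rfl fun b' hb' => ?_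
    rw [(Finset.mem_filter.1 hb').2]

/-- All three integrals are computed on the common partition given by `s.pair r`. -/
theorem IsStableRandomMeasure.simpleIntegral_sub_ae_eq (hM : IsStableRandomMeasure P α c M)
    {s r : SimpleFunc ℝ ℂ} (hs : s.FinMeasSupp volume) (hr : r.FinMeasSupp volume) :
    ∀ᵐ ω ∂P, simpleIntegral M (s - r) ω = simpleIntegral M s ω - simpleIntegral M r ω := by
  have hfin : ∀ g : ℂ × ℂ → ℂ, g 0 = 0 →
      ∀ b ∈ (s.pair r).range, g b ≠ 0 → volume (s.pair r ⁻¹' {b}) < ⊤ := fun g hg b _ hb =>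
    (hs.pair hr).meas_preimage_singleton_ne_zero fun h => hb (h ▸ hg)
  have h1 := hM.simpleIntegral_map_ae_eq (s.pair r) Prod.fst (hfin _ rfl)
  have h2 := hM.simpleIntegral_map_ae_eq (s.pair r) Prod.snd (hfin _ rfl)
  have h3 := hM.simpleIntegral_map_ae_eq (s.pair r) (fun b => b.1 - b.2) (hfin _ (by simp))
  filter_upwards [h1, h2, h3] with ω e1 e2 e3
  have c1 : (s.pair r).map Prod.fst = s := by ext; rfl
  have c2 : (s.pair r).map Prod.snd = r := by ext; rfl
  have c3 : (s.pair r).map (fun b => b.1 - b.2) = s - r := by ext; rfl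
  rw [c1] at e1
  rw [c2] at e2
  rw [c3] at e3
  rw [e1, e2, e3, ← Finset.sum_sub_distrib]
  exact Finset.sum_congr rfl fun b _ => by ring

theorem IsStableRandomMeasure.isIsotropicStable (hM : IsStableRandomMeasure P α c M) {A : Set ℝ}
    (hA : MeasurableSet A) (hfin : volume A < ⊤) :
    IsIsotropicStable (P.map (M A)) α (c * (volume A).toReal) := by
  intro z
  rw [hM.charFun_eq A hA hfin z]
  congr 3
  ring

theorem IsStableRandomMeasure.isIsotropicStable_sum (hM : IsStableRandomMeasure P α c M)
    {ι : Type} [Fintype ι] {A : ι → Set ℝ} (hA : ∀ i, MeasurableSet (A i))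
    (hfin : ∀ i, volume (A i) < ⊤) (hd : Pairwise (Function.onFun Disjoint A)) (a : ι → ℂ) :
    IsIsotropicStable (P.map fun ω => ∑ i, a i * M (A i) ω) α
      (c * ∑ i, ‖a i‖ ^ α * (volume (A i)).toReal) := by
  intro z
  have hm : ∀ i, Measurable (M (A i)) := fun i => hM.measurable _ (hA i) (hfin i)
  have hind : iIndepFun (fun i ω => a i * M (A i) ω) P :=
    (hM.indep ι A hA hfin hd).comp (fun i x => a i * x) fun i => measurable_const_mul (a i)
  rw [hind.charFun_map_fun_sum_eq_prod fun i => ((hm i).const_mul (a i)).aemeasurable,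
    Finset.prod_apply]
  have h1 : ∀ i, charFun (P.map fun ω => a i * M (A i) ω) z = Complex.exp
      (-((‖a i‖ ^ α * (c * (volume (A i)).toReal) * ‖z‖ ^ α : ℝ) : ℂ)) := fun i =>
    (hM.isIsotropicStable (hA i) (hfin i)).map_const_mul (hm i) (a i) z
  rw [Finset.prod_congr rfl fun i _ => h1 i, ← Complex.exp_sum, Finset.sum_neg_distrib,
    ← Complex.ofReal_sum]
  congr 3
  rw [Finset.mul_sum, Finset.sum_mul]
  exact Finset.sum_congr rfl fun i _ => by ring

theorem measurable_simpleIntegral (hM : IsStableRandomMeasure P α c M) {s : SimpleFunc ℝ ℂ}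
    (hs : s.FinMeasSupp volume) : Measurable (simpleIntegral M s) := by
  unfold simpleIntegral
  refine Finset.measurable_sum _ fun y _ => ?_
  by_cases hy : y = 0
  · simp [hy]
  · exact (hM.measurable _ (s.measurableSet_fiber y)
      (hs.meas_preimage_singleton_ne_zero hy)).const_mul y

/-- Characteristic functions of independent terms multiply, so weights add up to `c` times the
`α`-th power of the `L^α` size. This makes integration continuous from `L^α` to convergence in
probability. -/
theorem IsStableRandomMeasure.isIsotropicStable_simpleIntegral
    (hM : IsStableRandomMeasure P α c M) (hα : 0 < α) {s : SimpleFunc ℝ ℂ}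
    (hs : s.FinMeasSupp volume) :
    IsIsotropicStable (P.map (simpleIntegral M s)) α (c * (∫⁻ ξ, ‖s ξ‖ₑ ^ α).toReal) := by
  classical
  set S := s.range.filter (· ≠ 0)
  have hfin : ∀ y : S, volume (s ⁻¹' {(y : ℂ)}) < ⊤ := fun y =>
    hs.meas_preimage_singleton_ne_zero (Finset.mem_filter.1 y.2).2
  have h := hM.isIsotropicStable_sum (ι := S) (A := fun y => s ⁻¹' {(y : ℂ)})
    (fun y => s.measurableSet_fiber _) hfin
    (fun y y' hy => Disjoint.preimage s (Set.disjoint_singleton.2 fun h => hy (Subtype.ext h))) (fun y => (y : ℂ))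
  have e1 : simpleIntegral M s = fun ω => ∑ y : S, (y : ℂ) * M (s ⁻¹' {(y : ℂ)}) ω := by
    funext ω
    rw [Finset.sum_coe_sort S fun y => y * M (s ⁻¹' {y}) ω]
    unfold simpleIntegral
    refine (Finset.sum_filter_of_ne fun y _ hy => ?_).symm
    exact left_ne_zero_of_mul hy
  have e2 : (∫⁻ ξ, ‖s ξ‖ₑ ^ α).toReal =
      ∑ y : S, ‖(y : ℂ)‖ ^ α * (volume (s ⁻¹' {(y : ℂ)})).toReal := by
    have e3 : ∫⁻ ξ, ‖s ξ‖ₑ ^ α = ∑ y : S, ‖(y : ℂ)‖ₑ ^ α * volume (s ⁻¹' {(y : ℂ)}) := by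
      have := (s.map fun y => ‖y‖ₑ ^ α).lintegral_eq_lintegral volume
      rw [SimpleFunc.map_lintegral] at this
      simp only [SimpleFunc.map_apply] at this
      rw [this, Finset.sum_coe_sort S fun y => ‖y‖ₑ ^ α * volume (s ⁻¹' {y})]
      refine (Finset.sum_filter_of_ne fun y _ hy => ?_).symm
      rintro rfl
      refine hy ?_
      rw [ enorm_zero, ENNReal.zero_rpow_of_pos hα, zero_mul]
    rw [e3, ENNReal.toReal_sum]
    · refine Finset.sum_congr rfl fun y _ => ?_
      rw [ENNReal.toReal_mul, ← ENNReal.toReal_rpow, toReal_enorm]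
    · exact fun y _ => ENNReal.mul_ne_top (ENNReal.rpow_ne_top_of_nonneg hα.le enorm_ne_top)
        (hfin y).ne
  rw [e1, e2]
  exact h

theorem IsStableRandomMeasure.measureReal_simpleIntegral_sub_le [IsProbabilityMeasure P]
    (hM : IsStableRandomMeasure P α c M) (hc : 0 ≤ c) (hα : 0 < α) (hα2 : α ≤ 2)
    {s r : SimpleFunc ℝ ℂ} (hs : s.FinMeasSupp volume) (hr : r.FinMeasSupp volume) {η : ℝ}
    (hη : 0 < η) :
    P.real {ω | η < ‖simpleIntegral M s ω - simpleIntegral M r ω‖} ≤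
      64 * (c * (∫⁻ ξ, ‖s ξ - r ξ‖ₑ ^ α).toReal) * η ^ (-α) := by
  have hsr : (s - r).FinMeasSupp volume := by
    have := hs.map₂ hr (op := fun a b : ℂ => a - b) (sub_zero 0)
    exact this
  have h1 : P.real {ω | η < ‖simpleIntegral M s ω - simpleIntegral M r ω‖} =
      P.real {ω | η < ‖simpleIntegral M (s - r) ω‖} := by
    refine measureReal_congr ?_
    filter_upwards [hM.simpleIntegral_sub_ae_eq hs hr] with ω hω
    exact propext (by change η < _ ↔ η < _; rw [hω])
  have hm := measurable_simpleIntegral hM hsr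
  have := Measure.isProbabilityMeasure_map (μ := P) hm.aemeasurable
  have h2 := (hM.isIsotropicStable_simpleIntegral hα hsr).measureReal_norm_gt_le
    (by positivity) hα.le hα2 hη
  rw [map_measureReal_apply hm (measurableSet_lt measurable_const measurable_norm)] at h2
  rw [h1]
  exact h2

/-- The stable integral does not depend on the approximating simple functions. -/
theorem IsStableRandomMeasure.tendstoInMeasure_simpleIntegral [IsProbabilityMeasure P]
    (hM : IsStableRandomMeasure P α c M) (hc : 0 ≤ c) (hα : 1 ≤ α) (hα2 : α ≤ 2)
    {f : ℝ → ℂ} (hf : Measurable f) {Y : Ω → ℂ} (hY : IsStableIntegral P α M f Y)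
    {r : ℕ → SimpleFunc ℝ ℂ} (hr : ∀ n, (r n).FinMeasSupp volume)
    (hlim : Tendsto (fun n => ∫⁻ ξ, ‖r n ξ - f ξ‖ₑ ^ α) atTop (𝓝 0)) :
    TendstoInMeasure P (fun n => simpleIntegral M (r n)) atTop Y := by
  obtain ⟨-, -, s, hs, hslim, hsY⟩ := hY
  have hα0 : 0 < α := by linarith
  have hdiff : Tendsto (fun n => ∫⁻ ξ, ‖s n ξ - r n ξ‖ₑ ^ α) atTop (𝓝 0) := by
    -- Convexity of `t ↦ t ^ α`, which needs `1 ≤ α`.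
    have hub : Tendsto (fun n => (2 : ENNReal) ^ (α - 1) *
        ((∫⁻ ξ, ‖s n ξ - f ξ‖ₑ ^ α) + ∫⁻ ξ, ‖r n ξ - f ξ‖ₑ ^ α)) atTop (𝓝 0) := by
      have := ENNReal.Tendsto.const_mul (a := (2 : ENNReal) ^ (α - 1)) (hslim.add hlim)
        (Or.inr (ENNReal.rpow_ne_top_of_nonneg (by linarith) (by simp)))
      simpa using this
    refine tendsto_of_tendsto_of_tendsto_of_le_of_le tendsto_const_nhds hub
      (fun n => zero_le) fun n => ?_
    have hmeas : Measurable fun ξ => ‖s n ξ - f ξ‖ₑ ^ α :=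
      (((s n).measurable.sub hf).enorm).pow_const α
    dsimp only
    rw [← lintegral_add_left hmeas, ← lintegral_const_mul' _ _
      (ENNReal.rpow_ne_top_of_nonneg (by linarith) (by simp))]
    refine lintegral_mono fun ξ => ?_
    refine le_trans ?_ (ENNReal.rpow_add_le_mul_rpow_add_rpow _ _ hα)
    refine ENNReal.rpow_le_rpow ?_ hα0.le
    rw [show s n ξ - r n ξ = (s n ξ - f ξ) - (r n ξ - f ξ) by ring]
    exact enorm_sub_le
  rw [tendstoInMeasure_iff_measureReal_norm] at hsY ⊢
  intro e he
  have h1 := hsY (e / 2) (half_pos he)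
  have h2 : Tendsto (fun n => 64 * (c * (∫⁻ ξ, ‖s n ξ - r n ξ‖ₑ ^ α).toReal) * (e / 4) ^ (-α))
      atTop (𝓝 0) := by
    have := (((ENNReal.tendsto_toReal ENNReal.zero_ne_top).comp hdiff).const_mul c).const_mul 64
      |>.mul_const ((e / 4) ^ (-α))
    simpa using this
  have h3 := h1.add h2
  rw [add_zero] at h3
  refine tendsto_of_tendsto_of_tendsto_of_le_of_le tendsto_const_nhds h3
    (fun n => measureReal_nonneg) fun n => ?_
  have hsub : {ω | e ≤ ‖simpleIntegral M (r n) ω - Y ω‖} ⊆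
      {ω | e / 2 ≤ ‖simpleIntegral M (s n) ω - Y ω‖} ∪
        {ω | e / 4 < ‖simpleIntegral M (s n) ω - simpleIntegral M (r n) ω‖} := by
    intro ω hω
    simp only [Set.mem_ofPred_eq, Set.mem_union] at hω ⊢
    by_contra hcon
    push Not at hcon
    have := norm_sub_le (simpleIntegral M (s n) ω - Y ω)
      (simpleIntegral M (s n) ω - simpleIntegral M (r n) ω)
    rw [sub_sub_sub_cancel_left] at this
    linarith [hcon.1, hcon.2]
  exact (measureReal_mono hsub).trans ((measureReal_union_le _ _).trans (add_le_add le_rfl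
    (hM.measureReal_simpleIntegral_sub_le hc hα0 hα2 (hs n) (hr n) (by positivity))))

end RandomMeasure

/-! ### Discretization on a partition common to all integrands. -/

/-- Simple functions approximating the identity on `[-R, R]` and equal to `R + 1` elsewhere. -/
noncomputable def samplePoint (R : ℝ) (n : ℕ) : SimpleFunc ℝ ℝ :=
  SimpleFunc.piecewise (Set.Icc (-R) R) measurableSet_Icc
    (SimpleFunc.approxOn id measurable_id Set.univ 0 trivial n) (SimpleFunc.const ℝ (R + 1))

theorem samplePoint_of_notMem {R ξ : ℝ} (hξ : ξ ∉ Set.Icc (-R) R) (n : ℕ) :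
    samplePoint R n ξ = R + 1 := by
  rw [samplePoint, SimpleFunc.coe_piecewise]
  exact if_neg hξ

theorem tendsto_samplePoint {R ξ : ℝ} (hξ : ξ ∈ Set.Icc (-R) R) :
    Tendsto (fun n => samplePoint R n ξ) atTop (𝓝 ξ) := by
  have h : ∀ n, samplePoint R n ξ =
      SimpleFunc.approxOn id measurable_id Set.univ (0 : ℝ) trivial n ξ := fun n => by
    rw [samplePoint, SimpleFunc.coe_piecewise]
    exact if_pos hξ
  simp only [h]
  exact SimpleFunc.tendsto_approxOn (f := (id : ℝ → ℝ)) (s := Set.univ) measurable_id trivial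
    (by simp)

theorem samplePoint_preimage_subset {R b : ℝ} (hb : b ≠ R + 1) (n : ℕ) :
    samplePoint R n ⁻¹' {b} ⊆ Set.Icc (-R) R := by
  intro ξ hξ
  by_contra h
  exact hb (hξ.symm.trans (samplePoint_of_notMem h n))

section Discretization

variable {f : ℝ → ℂ} {R B : ℝ}

/-- Outside `[-R, R]` the sample point is `R + 1`, where every function supported in `[-R, R]`
vanishes. -/
theorem finMeasSupp_samplePoint_map (hR : ∀ ξ, R < |ξ| → f ξ = 0) (n : ℕ) :
    ((samplePoint R n).map f).FinMeasSupp volume := by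
  rw [SimpleFunc.finMeasSupp_iff_support]
  refine (measure_mono (t := Set.Icc (-R) R) fun ξ hξ => ?_).trans_lt measure_Icc_lt_top
  by_contra h
  refine hξ ?_
  rw [SimpleFunc.map_apply, samplePoint_of_notMem h]
  exact hR _ ((lt_add_one R).trans_le (le_abs_self _))

theorem tendsto_lintegral_samplePoint_map {α : ℝ} (hα : 0 < α) (hf : Continuous f)
    (hR : ∀ ξ, R < |ξ| → f ξ = 0) (hB : ∀ ξ, ‖f ξ‖ ≤ B) :
    Tendsto (fun n => ∫⁻ ξ, ‖(samplePoint R n).map f ξ - f ξ‖ₑ ^ α) atTop (𝓝 0) := by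
  have hB0 : 0 ≤ B := (norm_nonneg _).trans (hB 0)
  have hout : ∀ n, ∀ ξ ∉ Set.Icc (-R) R, (samplePoint R n).map f ξ - f ξ = 0 := fun n ξ hξ => by
    rw [SimpleFunc.map_apply, samplePoint_of_notMem hξ,
      hR _ ((lt_add_one R).trans_le (le_abs_self _)), hR ξ, sub_zero]
    by_contra hcon
    exact hξ (abs_le.1 (not_lt.1 hcon))
  have h := tendsto_lintegral_of_dominated_convergence (μ := volume)
    (F := fun n ξ => ‖(samplePoint R n).map f ξ - f ξ‖ₑ ^ α) (f := fun _ => 0)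
    ((Set.Icc (-R) R).indicator fun _ => ENNReal.ofReal (B + B) ^ α)
    (fun n => ((((samplePoint R n).map f).measurable.sub hf.measurable).enorm).pow_const α)
    (fun n => ae_of_all _ fun ξ => ?_) ?_ (ae_of_all _ fun ξ => ?_)
  · simpa using h
  · by_cases hξ : ξ ∈ Set.Icc (-R) R
    · rw [Set.indicator_of_mem hξ]
      refine ENNReal.rpow_le_rpow ?_ hα.le
      rw [← ofReal_norm]
      exact ENNReal.ofReal_le_ofReal ((norm_sub_le _ _).trans (add_le_add (hB _) (hB _)))
    · simp only [hout n ξ hξ, enorm_zero, ENNReal.zero_rpow_of_pos hα]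
      exact zero_le
  · rw [lintegral_indicator_const measurableSet_Icc]
    exact ENNReal.mul_ne_top (ENNReal.rpow_ne_top_of_nonneg hα.le ENNReal.ofReal_ne_top)
      measure_Icc_lt_top.ne
  · by_cases hξ : ξ ∈ Set.Icc (-R) R
    · have h1 : Tendsto (fun n => f (samplePoint R n ξ) - f ξ) atTop (𝓝 0) := by
        have := ((hf.tendsto ξ).comp (tendsto_samplePoint hξ)).sub_const (f ξ)
        rwa [sub_self] at this
      have h2 := ((ENNReal.continuous_rpow_const (y := α)).tendsto _).comp h1.enorm
      simpa [Function.comp_def, ENNReal.zero_rpow_of_pos hα] using h2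
    · simp only [hout _ ξ hξ, enorm_zero, ENNReal.zero_rpow_of_pos hα]
      exact tendsto_const_nhds

end Discretization

/-! ### Maximal inequality for stable integrals. -/

/-- The bound of the maximal inequality for `N` sums, with total weight `W`, truncation levels `τ`
and `x`, and thresholds `t` and `u`. -/
noncomputable def maximalBound (α W τ x J t u N : ℝ) : ℝ :=
  64 * W * x ^ (-α) + Real.exp (128 * W * (J * x ^ (-α) + τ ^ (-α) / J) - u) +
    N * (2 * Real.exp (64 * W * τ ^ (-α) - t))

section MaximalIntegral

variable {Ω : Type*} [MeasurableSpace Ω] {P : Measure Ω} [IsProbabilityMeasure P] {α c : ℝ}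
  {M : Set ℝ → Ω → ℂ} {κ : Type*} {f : κ → ℝ → ℂ} {R B : ℝ}

/-- The cells of `samplePoint R n` serve all `k` at once: the variables are `B * M (A b)`, the
coefficients `f k b / B`. The bound is independent of `n`. -/
theorem IsStableRandomMeasure.measureReal_exists_re_simpleIntegral_gt_le
    (hM : IsStableRandomMeasure P α c M) (hc : 0 ≤ c) (hα : 0 < α) (hα2 : α ≤ 2)
    (hR0 : 0 ≤ R) (hR : ∀ k ξ, R < |ξ| → f k ξ = 0) (hB0 : 0 < B) (hB : ∀ k ξ, ‖f k ξ‖ ≤ B)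
    {τ x J : ℝ} (hτ : 0 < τ) (hx : 0 < x) (hJ : 0 < J) (t u : ℝ) (S : Finset κ) (n : ℕ) :
    P.real {ω | ∃ k ∈ S, t * τ + u * x < |(simpleIntegral M ((samplePoint R n).map (f k)) ω).re|} ≤
      maximalBound α (B ^ α * (c * (2 * R))) τ x J t u S.card := by
  classical
  set p := samplePoint R n
  set I := p.range.filter (· ≠ R + 1)
  have hI : ∀ b : I, (b : ℝ) ≠ R + 1 := fun b => (Finset.mem_filter.1 b.2).2
  have hf0 : ∀ k, f k (R + 1) = 0 := fun k => hR k _ ((lt_add_one R).trans_le (le_abs_self _))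
  set A : I → Set ℝ := fun b => p ⁻¹' {(b : ℝ)}
  have hA : ∀ b, MeasurableSet (A b) := fun b => p.measurableSet_fiber _
  have hAsub : ∀ b, A b ⊆ Set.Icc (-R) R := fun b => samplePoint_preimage_subset (hI b) n
  have hAfin : ∀ b, volume (A b) < ⊤ := fun b =>
    (measure_mono (hAsub b)).trans_lt measure_Icc_lt_top
  have hd : Pairwise (Function.onFun Disjoint A) := fun b b' hb =>
    Disjoint.preimage p (Set.disjoint_singleton.2 fun h => hb (Subtype.ext h))
  have hvol : ∑ b, (volume (A b)).toReal ≤ 2 * R := by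
    have h1 : volume (⋃ b, A b) = ∑ b, volume (A b) := by
      rw [measure_iUnion hd hA, tsum_fintype]
    have h2 : volume (⋃ b, A b) ≤ ENNReal.ofReal (2 * R) := by
      refine (measure_mono (Set.iUnion_subset hAsub)).trans ?_
      rw [Real.volume_Icc]
      exact ENNReal.ofReal_le_ofReal (by linarith)
    rw [← ENNReal.toReal_sum fun b _ => (hAfin b).ne, ← h1]
    exact ENNReal.toReal_le_of_le_ofReal (by linarith) h2
  have hm : ∀ b, Measurable (M (A b)) := fun b => hM.measurable _ (hA b) (hAfin b)
  set X : I → Ω → ℂ := fun b ω => (B : ℂ) * M (A b) ω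
  have hX : ∀ b, Measurable (X b) := fun b => (hm b).const_mul _
  have hind : iIndepFun X P := (hM.indep I A hA hAfin hd).comp (fun _ z => (B : ℂ) * z)
    fun _ => measurable_const_mul _
  have hst : ∀ b, IsIsotropicStable (P.map (X b)) α (B ^ α * (c * (volume (A b)).toReal)) := by
    intro b
    have := (hM.isIsotropicStable (hA b) (hAfin b)).map_const_mul (hm b) (B : ℂ)
    rwa [Complex.norm_real, Real.norm_eq_abs, abs_of_pos hB0] at this
  have hW : ∑ b, B ^ α * (c * (volume (A b)).toReal) ≤ B ^ α * (c * (2 * R)) := by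
    rw [← Finset.mul_sum, ← Finset.mul_sum]
    gcongr
  have ha : ∀ (k : κ) (b : I), ‖f k b / B‖ ≤ 1 := fun k b => by
    rw [norm_div, Complex.norm_real, Real.norm_eq_abs, abs_of_pos hB0]
    exact (div_le_one hB0).2 (hB k b)
  have key := measureReal_exists_re_sum_gt_le hX hind hst
    (fun b => by positivity) hW hα.le hα2 hτ hx hJ t u S (a := fun k b => f k b / B) ha
  refine le_trans (le_of_eq (measureReal_congr ?_)) key
  have hae : ∀ k ∈ S, ∀ᵐ ω ∂P,
      simpleIntegral M (p.map (f k)) ω = ∑ b : I, f k b / B * X b ω := by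
    intro k _
    have h1 := hM.simpleIntegral_map_ae_eq p (f k) fun b _ hb =>
      (measure_mono (samplePoint_preimage_subset (fun h : b = R + 1 => hb (h ▸ hf0 k)) n)).trans_lt
        measure_Icc_lt_top
    filter_upwards [h1] with ω hω
    have hBC : (B : ℂ) ≠ 0 := by exact_mod_cast hB0.ne'
    have h2 : ∀ b : I, f k b / B * X b ω = f k b * M (p ⁻¹' {(b : ℝ)}) ω := fun b => by
      simp only [X, A]
      field_simp
    rw [hω, Finset.sum_congr rfl fun b _ => h2 b,
      Finset.sum_coe_sort I fun b => f k b * M (p ⁻¹' {b}) ω]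
    refine (Finset.sum_filter_of_ne fun b _ hb => ?_).symm
    rintro rfl
    exact hb (by rw [hf0, zero_mul])
  filter_upwards [(Finset.eventually_all _).2 hae] with ω hω
  refine propext ⟨?_, ?_⟩ <;> rintro ⟨k, hk, h⟩ <;> refine ⟨k, hk, ?_⟩
  · rwa [hω k hk] at h
  · rwa [hω k hk]

/-- Maximal inequality for finitely many stable integrals of functions with a common bound and a
common bounded support. -/
theorem IsStableRandomMeasure.measureReal_exists_re_integral_gt_le
    (hM : IsStableRandomMeasure P α c M) (hc : 0 ≤ c) (hα : 1 ≤ α) (hα2 : α ≤ 2)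
    (hf : ∀ k, Continuous (f k)) (hR0 : 0 ≤ R) (hR : ∀ k ξ, R < |ξ| → f k ξ = 0) (hB0 : 0 < B)
    (hB : ∀ k ξ, ‖f k ξ‖ ≤ B) {Y : κ → Ω → ℂ} (hY : ∀ k, IsStableIntegral P α M (f k) (Y k))
    {τ x J : ℝ} (hτ : 0 < τ) (hx : 0 < x) (hJ : 0 < J) (t u : ℝ) {A : ℝ} (hA : 0 < A)
    (S : Finset κ) :
    P.real {ω | ∃ k ∈ S, t * τ + u * x + A < |(Y k ω).re|} ≤
      maximalBound α (B ^ α * (c * (2 * R))) τ x J t u S.card := by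
  have hα0 : 0 < α := by linarith
  set r : κ → ℕ → SimpleFunc ℝ ℂ := fun k n => (samplePoint R n).map (f k)
  have hlim : ∀ k, Tendsto (fun n => P.real {ω | A ≤ ‖simpleIntegral M (r k n) ω - Y k ω‖})
      atTop (𝓝 0) := fun k =>
    tendstoInMeasure_iff_measureReal_norm.1 (hM.tendstoInMeasure_simpleIntegral hc hα hα2
      (hf k).measurable (hY k) (fun n => finMeasSupp_samplePoint_map (hR k) n)
      (tendsto_lintegral_samplePoint_map hα0 (hf k) (hR k) (hB k))) A hA
  -- Since `S` is finite, the probabilities of an approximation error of at least `A` add up to a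
  -- null sequence.
  have hsum := (tendsto_finsetSum S fun k _ => hlim k).const_add
    (maximalBound α (B ^ α * (c * (2 * R))) τ x J t u S.card)
  rw [Finset.sum_const_zero, add_zero] at hsum
  refine ge_of_tendsto' hsum fun n => ?_
  have hsub : {ω | ∃ k ∈ S, t * τ + u * x + A < |(Y k ω).re|} ⊆
      {ω | ∃ k ∈ S, t * τ + u * x < |(simpleIntegral M (r k n) ω).re|} ∪
        ⋃ k ∈ S, {ω | A ≤ ‖simpleIntegral M (r k n) ω - Y k ω‖} := by
    rintro ω ⟨k, hk, h⟩
    by_cases hA' : A ≤ ‖simpleIntegral M (r k n) ω - Y k ω‖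
    · exact Or.inr (Set.mem_biUnion hk hA')
    · refine Or.inl ⟨k, hk, ?_⟩
      have h1 := Complex.abs_re_le_norm (simpleIntegral M (r k n) ω - Y k ω)
      rw [Complex.sub_re, abs_sub_comm] at h1
      have h2 := abs_sub_abs_le_abs_sub (Y k ω).re (simpleIntegral M (r k n) ω).re
      linarith [not_le.1 hA']
  exact (measureReal_mono hsub).trans ((measureReal_union_le _ _).trans (add_le_add
    (hM.measureReal_exists_re_simpleIntegral_gt_le hc hα0 hα2 hR0 hR hB0 hB hτ hx hJ t u S n)
    (measureReal_biUnion_finset_le _ _)))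

end MaximalIntegral

/-! ### Size and support of the wavelet kernels. -/

section Kernel

variable (ψ : SchwartzMap ℝ ℝ)

theorem norm_hat_integrand (ξ x : ℝ) :
    ‖Complex.exp (-(Complex.I * ξ * x)) * (ψ x : ℂ)‖ = ‖ψ x‖ := by
  rw [norm_mul, show -(Complex.I * ξ * x) = ((-(ξ * x) : ℝ) : ℂ) * Complex.I by push_cast; ring,
    Complex.norm_exp_ofReal_mul_I, one_mul, Complex.norm_real]

theorem continuous_hat : Continuous (hat ψ) := by
  unfold hat
  refine continuous_of_dominated (bound := fun x => ‖ψ x‖) (fun ξ => ?_)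
    (fun ξ => ae_of_all _ fun x => (norm_hat_integrand ψ ξ x).le) ψ.integrable.norm
    (ae_of_all _ fun x => by fun_prop)
  have := ψ.continuous
  fun_prop

theorem norm_hat_le (ξ : ℝ) : ‖hat ψ ξ‖ ≤ ∫ x, ‖ψ x‖ := by
  refine (norm_integral_le_integral_norm _).trans (le_of_eq ?_)
  exact integral_congr_ae (ae_of_all _ fun x => norm_hat_integrand ψ ξ x)

theorem continuous_kernel (α : ℝ) (j k : ℤ) : Continuous (kernel α ψ j k) := by
  have := continuous_hat ψ
  unfold kernel
  fun_prop

theorem norm_kernel_le (α : ℝ) (j k : ℤ) (ξ : ℝ) :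
    ‖kernel α ψ j k ξ‖ ≤ (2 : ℝ) ^ (-(j : ℝ) / α) * ((∫ x, ‖ψ x‖) + 1) := by
  unfold kernel
  rw [norm_mul, norm_mul, mul_comm Complex.I, Complex.norm_exp_ofReal_mul_I, mul_one,
    Complex.norm_real, Real.norm_eq_abs, abs_of_pos (by positivity)]
  gcongr
  linarith [norm_hat_le ψ (-((2 : ℝ) ^ (-j) * ξ))]

variable {ψ}

/-- The constant 9 comes from `8 * π / 3 < 9`. -/
theorem IsMeyerWavelet.kernel_eq_zero (hψ : IsMeyerWavelet ψ) (α : ℝ) (j k : ℤ) {ξ : ℝ}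
    (hξ : 9 * (2 : ℝ) ^ j < |ξ|) : kernel α ψ j k ξ = 0 := by
  have h0 : hat ψ (-((2 : ℝ) ^ (-j) * ξ)) = 0 := by
    by_contra hne
    have h1 := (hψ.tsupport_hat (subset_tsupport _ hne)).2
    rw [abs_neg, abs_mul, abs_of_pos (by positivity), zpow_neg, inv_mul_le_iff₀ (by positivity)]
      at h1
    have h2 : (2 : ℝ) ^ j * (8 * Real.pi / 3) ≤ 9 * (2 : ℝ) ^ j := by
      have h3 : (0 : ℝ) < 2 ^ j := by positivity
      nlinarith [Real.pi_lt_d2]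
    linarith
  rw [kernel, h0, mul_zero]

end Kernel

/-! ### Choice of the truncation levels and summability over scales. -/

/-- Exceptional probability at scale `J = 1 + j`. -/
noncomputable def scaleBound (α δ ρ W : ℝ) (j : ℕ) : ℝ :=
  64 * W * (1 + (j : ℝ)) ^ (-(1 + α * (δ / 2))) +
    Real.exp (256 * W) * Real.exp (-(1 + (j : ℝ)) ^ (δ / 2)) +
    2 * (2 * ρ + 3) *
      Real.exp ((64 * W + 1) * (1 + (j : ℝ)) - (1 + (j : ℝ)) ^ (2 / α + δ))

theorem tendsto_one_add_nat_atTop : Tendsto (fun j : ℕ => 1 + (j : ℝ)) atTop atTop :=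
  tendsto_atTop_add_const_left _ _ tendsto_natCast_atTop_atTop

theorem summable_one_add_nat_rpow {p : ℝ} (hp : p < -1) :
    Summable fun j : ℕ => (1 + (j : ℝ)) ^ p := by
  have := (summable_nat_add_iff 1).2 (Real.summable_nat_rpow.2 hp)
  simpa [add_comm] using this

theorem summable_scaleBound {α δ : ℝ} (hα : 0 < α) (hα2 : α ≤ 2) (hδ : 0 < δ) (ρ W : ℝ) :
    Summable (scaleBound α δ ρ W) := by
  refine Summable.add (Summable.add ?_ ?_) ?_
  · have : 0 < α * (δ / 2) := by positivity
    exact (summable_one_add_nat_rpow (by linarith)).mul_left _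
  · refine Summable.mul_left _ ?_
    have hs : Summable fun j : ℕ => (1 + (j : ℝ)) ^ (-2 : ℝ) :=
      summable_one_add_nat_rpow (by norm_num)
    refine summable_of_isBigO_nat hs ?_
    -- With `y = (1 + j) ^ (δ / 2)`, the power `y ^ (-4 / δ)` is `(1 + j) ^ (-2)`.
    have h1 := (isLittleO_exp_neg_mul_rpow_atTop one_pos (-4 / δ)).isBigO
    have h2 := h1.comp_tendsto ((tendsto_rpow_atTop (half_pos hδ)).comp tendsto_one_add_nat_atTop)
    refine h2.congr (fun j => ?_) (fun j => ?_)
    · simp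
    · simp only [Function.comp]
      rw [← Real.rpow_mul (by positivity)]
      congr 1
      field_simp
      norm_num
  · refine Summable.mul_left _ ?_
    have hs : Summable fun j : ℕ => Real.exp (-(j : ℝ)) := Real.summable_exp_neg_nat
    refine Summable.of_norm_bounded_eventually_nat hs ?_
    -- Since `α ≤ 2`, the power `2 / α + δ` exceeds one and beats the linear term in the exponent.
    have hexp : 0 < 2 / α + δ - 1 := by
      have : 1 ≤ 2 / α := (one_le_div hα).2 hα2
      linarith
    have ht := (tendsto_rpow_atTop hexp).comp tendsto_one_add_nat_atTop
    filter_upwards [ht.eventually_ge_atTop (64 * W + 2)] with j hj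
    have hJ : (0 : ℝ) < 1 + j := by positivity
    rw [Real.norm_eq_abs, Real.abs_exp, Real.exp_le_exp]
    have e : (1 + (j : ℝ)) ^ (2 / α + δ) = (1 + (j : ℝ)) * (1 + (j : ℝ)) ^ (2 / α + δ - 1) := by
      rw [Real.rpow_sub_one hJ.ne']; field_simp
    rw [e]
    simp only [Function.comp] at hj
    nlinarith [mul_le_mul_of_nonneg_left hj hJ.le]

/-- The levels are chosen so that `τ ^ (-α) = J` and `J * x ^ (-α) ≤ 1`. The middle exponent is then
at most `256 * W - u`, and the factor `2 ^ j ≤ exp J` turns `64 * W` into `64 * W + 1` in the last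
term. -/
theorem maximalBound_le_scaleBound {α δ ρ W N : ℝ} (hα : 0 < α) (hδ : 0 < δ) (hW : 0 ≤ W)
    (hρ : 0 ≤ ρ) {j : ℕ} (hN : N ≤ (2 * ρ + 3) * 2 ^ j) :
    maximalBound α W ((1 + (j : ℝ)) ^ (-(1 / α))) ((1 + (j : ℝ)) ^ (1 / α + δ / 2)) (1 + j)
      ((1 + (j : ℝ)) ^ (2 / α + δ)) ((1 + (j : ℝ)) ^ (δ / 2)) N ≤ scaleBound α δ ρ W j := by
  have hJ : (0 : ℝ) < 1 + j := by positivity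
  have hJ1 : (1 : ℝ) ≤ 1 + j := by simp
  have e1 : ((1 + (j : ℝ)) ^ (-(1 / α))) ^ (-α) = 1 + j := by
    rw [← Real.rpow_mul hJ.le, show -(1 / α) * -α = 1 by field_simp, Real.rpow_one]
  have e2 : ((1 + (j : ℝ)) ^ (1 / α + δ / 2)) ^ (-α) = (1 + (j : ℝ)) ^ (-(1 + α * (δ / 2))) := by
    rw [← Real.rpow_mul hJ.le]
    congr 1
    field_simp
  have e3 : (1 + (j : ℝ)) * (1 + (j : ℝ)) ^ (-(1 + α * (δ / 2))) ≤ 1 := by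
    have : (1 + (j : ℝ)) ^ (-(1 + α * (δ / 2))) ≤ (1 + (j : ℝ)) ^ (-1 : ℝ) :=
      Real.rpow_le_rpow_of_exponent_le hJ1 (by
        have : 0 < α * (δ / 2) := by positivity
        linarith)
    rw [Real.rpow_neg_one] at this
    calc _ ≤ (1 + (j : ℝ)) * (1 + (j : ℝ))⁻¹ := by gcongr
      _ = 1 := mul_inv_cancel₀ hJ.ne'
  unfold maximalBound scaleBound
  rw [e1, e2, div_self hJ.ne']
  refine add_le_add (add_le_add le_rfl ?_) ?_
  · rw [← Real.exp_add, Real.exp_le_exp]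
    nlinarith
  · have h2 : (2 : ℝ) ^ j ≤ Real.exp (1 + j) := by
      calc (2 : ℝ) ^ j ≤ Real.exp 1 ^ j := by
            gcongr
            linarith [Real.add_one_le_exp 1]
        _ = Real.exp j := by rw [← Real.exp_nat_mul, mul_one]
        _ ≤ _ := Real.exp_le_exp.2 (by linarith)
    calc N * (2 * Real.exp (64 * W * (1 + j) - (1 + (j : ℝ)) ^ (2 / α + δ)))
        ≤ ((2 * ρ + 3) * Real.exp (1 + j)) *
          (2 * Real.exp (64 * W * (1 + j) - (1 + (j : ℝ)) ^ (2 / α + δ))) := by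
          gcongr
          exact hN.trans (by gcongr)
      _ = 2 * (2 * ρ + 3) * (Real.exp (1 + j) *
          Real.exp (64 * W * (1 + j) - (1 + (j : ℝ)) ^ (2 / α + δ))) := by ring
      _ = _ := by rw [← Real.exp_add]; ring_nf

/-- The translation indices `k` with `|2^{-j} k| ≤ ρ` form a finite set with `O(2^j)` elements. -/
theorem exists_finset_translations {ρ : ℝ} (hρ : 0 ≤ ρ) (j : ℕ) :
    ∃ S : Finset ℤ, (S.card : ℝ) ≤ (2 * ρ + 3) * 2 ^ j ∧
      ∀ k : ℤ, |(2 : ℝ) ^ (-(j : ℤ)) * (k : ℝ)| ≤ ρ → k ∈ S := by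
  have h2 : (1 : ℝ) ≤ 2 ^ j := one_le_pow₀ (by norm_num)
  set m : ℕ := ⌊ρ * 2 ^ j⌋₊
  have hm : (m : ℝ) ≤ ρ * 2 ^ j := Nat.floor_le (by positivity)
  refine ⟨Finset.Icc (-(m : ℤ)) m, ?_, fun k hk => ?_⟩
  · have hcard : (Finset.Icc (-(m : ℤ)) m).card = 2 * m + 1 := by
      rw [Int.card_Icc]; omega
    rw [hcard]
    push_cast
    nlinarith
  · rw [abs_mul, abs_of_pos (by positivity), zpow_neg, zpow_natCast,
      inv_mul_le_iff₀ (by positivity)] at hk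
    have h3 : k.natAbs ≤ m := Nat.le_floor (by
      rw [Nat.cast_natAbs, Int.cast_abs]; linarith)
    rw [Finset.mem_Icc]
    omega

/-! ### Borel–Cantelli and conclusion. -/

/-- Borel–Cantelli in the form of a random constant: if the maxima over finite sets `S j` exceed
`a j` with summable probabilities, they are bounded by a random multiple of `a j`. -/
theorem exists_random_bound {Ω : Type*} [MeasurableSpace Ω] {P : Measure Ω}
    [IsProbabilityMeasure P] {κ : Type*} {Z : ℕ → κ → Ω → ℝ}
    (hZ : ∀ j k, Measurable (Z j k)) (S : ℕ → Finset κ) {a : ℕ → ℝ} (ha : ∀ j, 0 < a j) {b : ℝ}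
    {q : ℕ → ℝ} (hq : Summable q)
    (hP : ∀ j, P.real {ω | ∃ k ∈ S j, b * a j < |Z j k ω|} ≤ q j) :
    ∃ (Ωstar : Set Ω) (C : Ω → ℝ), MeasurableSet Ωstar ∧ P Ωstar = 1 ∧ Measurable C ∧
      (∀ ω, 0 < C ω) ∧ ∀ ω ∈ Ωstar, ∀ j, ∀ k ∈ S j, |Z j k ω| ≤ C ω * a j := by
  set G : Ω → ENNReal := fun ω => ⨆ j, ⨆ k ∈ S j, ENNReal.ofReal (|Z j k ω| / a j)
  have hG : Measurable G := by
    refine Measurable.iSup fun j => ?_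
    refine Measurable.biSup (S j : Set κ) (S j).countable_toSet fun k _ => ?_
    have := hZ j k
    exact ((measurable_norm.comp this).div_const _).ennreal_ofReal
  -- Adding 1 makes the constant positive everywhere, including where `G` is zero or infinite.
  refine ⟨{ω | G ω < ⊤}, fun ω => 1 + (G ω).toReal, measurableSet_lt hG measurable_const, ?_,
    measurable_const.add hG.ennreal_toReal, fun ω => by positivity, fun ω hω j k hk => ?_⟩
  · have hsum : ∑' j, P {ω | ∃ k ∈ S j, b * a j < |Z j k ω|} ≠ ⊤ := by
      have h1 : ∀ j, P {ω | ∃ k ∈ S j, b * a j < |Z j k ω|} ≤ ENNReal.ofReal (q j) := fun j => by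
        rw [← ofReal_measureReal]
        exact ENNReal.ofReal_le_ofReal (hP j)
      exact ne_top_of_le_ne_top hq.tsum_ofReal_ne_top (ENNReal.tsum_le_tsum h1)
    rw [← mem_ae_iff_prob_eq_one (measurableSet_lt hG measurable_const)]
    filter_upwards [ae_eventually_notMem hsum] with ω hω
    obtain ⟨N, hN⟩ := eventually_atTop.1 hω
    -- From scale `N` on the ratios are at most `b`; the earlier ones are finitely many and are
    -- bounded by their sum.
    have hle : G ω ≤ ENNReal.ofReal b +
        ∑ j ∈ Finset.range N, ∑ k ∈ S j, ENNReal.ofReal (|Z j k ω| / a j) := by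
      refine iSup_le fun j => iSup₂_le fun k hk => ?_
      by_cases hj : j < N
      · refine le_add_left (le_trans ?_ (Finset.single_le_sum
          (f := fun j => ∑ k ∈ S j, ENNReal.ofReal (|Z j k ω| / a j)) (fun _ _ => zero_le)
          (Finset.mem_range.2 hj)))
        exact Finset.single_le_sum (f := fun k => ENNReal.ofReal (|Z j k ω| / a j))
          (fun _ _ => zero_le) hk
      · refine le_add_right (ENNReal.ofReal_le_ofReal ((div_le_iff₀ (ha j)).2 ?_))
        by_contra hcon
        exact hN j (not_lt.1 hj) ⟨k, hk, not_le.1 hcon⟩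
    refine hle.trans_lt (ENNReal.add_lt_top.2 ⟨ENNReal.ofReal_lt_top, ?_⟩)
    exact ENNReal.sum_lt_top.2 fun j _ => ENNReal.sum_lt_top.2 fun k _ => ENNReal.ofReal_lt_top
  · have h1 : ENNReal.ofReal (|Z j k ω| / a j) ≤ G ω :=
      le_trans (le_iSup₂_of_le (f := fun k (_ : k ∈ S j) => ENNReal.ofReal (|Z j k ω| / a j)) k hk
        le_rfl) (le_iSup (fun j => ⨆ k ∈ S j, ENNReal.ofReal (|Z j k ω| / a j)) j)
    have h2 := (ENNReal.ofReal_le_iff_le_toReal (ne_of_lt hω)).1 h1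
    rw [div_le_iff₀ (ha j)] at h2
    have := ha j
    nlinarith

end HFSM

theorem mainTheorem3 {Ω : Type*} [MeasurableSpace Ω] (P : Measure Ω) [IsProbabilityMeasure P]
    (α c : ℝ) (hα : α ∈ Set.Ico (1 : ℝ) 2) (hc : 0 < c)
    (M : Set ℝ → Ω → ℂ) (hM : HFSM.IsStableRandomMeasure P α c M)
    (ψ : SchwartzMap ℝ ℝ) (hψ : HFSM.IsMeyerWavelet ψ)
    (ε : ℤ → ℤ → Ω → ℂ)
    (hε : ∀ j k : ℤ, HFSM.IsStableIntegral P α M (HFSM.kernel α ψ j k) (ε j k))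
    (δ ρ : ℝ) (hδ : 0 < δ) (hρ : 0 < ρ) :
    ∃ (Ωstar : Set Ω) (C : Ω → ℝ),
      MeasurableSet Ωstar ∧ P Ωstar = 1 ∧ Measurable C ∧ (∀ ω, 0 < C ω) ∧
      ∀ ω ∈ Ωstar, ∀ (j : ℕ) (k : ℤ), |(2 : ℝ) ^ (-(j : ℤ)) * (k : ℝ)| ≤ ρ →
        |(ε j k ω).re| ≤ C ω * (1 + (j : ℝ)) ^ (1 / α + δ) := by
  have hα0 : 0 < α := by linarith [hα.1]
  choose S hScard hS using HFSM.exists_finset_translations hρ.le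
  -- The added 1 gives a positive bound without a lower bound on the integral.
  set H : ℝ := (∫ x, ‖ψ x‖) + 1
  have hH : 0 < H := by positivity
  -- The kernel bound to the power `α` gives `2 ^ (-j) * H ^ α`, and the interval has length `18 * 2
  -- ^ j`; the powers of two cancel.
  set W : ℝ := 18 * c * H ^ α
  have hprob : ∀ j : ℕ, P.real {ω | ∃ k ∈ S j,
      -- One multiple each for the small part, the middle part and the approximation error.
      3 * (1 + (j : ℝ)) ^ (1 / α + δ) < |(ε j k ω).re|} ≤ HFSM.scaleBound α δ ρ W j := by
    intro j
    have hJ : (0 : ℝ) < 1 + j := by positivity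
    have h := hM.measureReal_exists_re_integral_gt_le hc.le hα.1 hα.2.le
      (fun k => HFSM.continuous_kernel ψ α j k) (R := 9 * (2 : ℝ) ^ (j : ℤ)) (by positivity)
      (fun k ξ hξ => hψ.kernel_eq_zero α j k hξ)
      (B := (2 : ℝ) ^ (-((j : ℤ) : ℝ) / α) * H) (by positivity)
      (fun k ξ => HFSM.norm_kernel_le ψ α j k ξ) (fun k => hε j k)
      (τ := (1 + (j : ℝ)) ^ (-(1 / α))) (x := (1 + (j : ℝ)) ^ (1 / α + δ / 2)) (by positivity)
      (by positivity) hJ ((1 + (j : ℝ)) ^ (2 / α + δ)) ((1 + (j : ℝ)) ^ (δ / 2))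
      (A := (1 + (j : ℝ)) ^ (1 / α + δ)) (by positivity) (S j)
    have e1 : (1 + (j : ℝ)) ^ (2 / α + δ) * (1 + (j : ℝ)) ^ (-(1 / α)) +
        (1 + (j : ℝ)) ^ (δ / 2) * (1 + (j : ℝ)) ^ (1 / α + δ / 2) + (1 + (j : ℝ)) ^ (1 / α + δ) =
        3 * (1 + (j : ℝ)) ^ (1 / α + δ) := by
      rw [← Real.rpow_add hJ, ← Real.rpow_add hJ,
        show 2 / α + δ + -(1 / α) = 1 / α + δ by ring,
        show δ / 2 + (1 / α + δ / 2) = 1 / α + δ by ring]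
      ring
    have e2 : ((2 : ℝ) ^ (-((j : ℤ) : ℝ) / α) * H) ^ α * (c * (2 * (9 * (2 : ℝ) ^ (j : ℤ)))) =
        W := by
      rw [Real.mul_rpow (by positivity) hH.le, ← Real.rpow_mul (by norm_num),
        div_mul_cancel₀ _ hα0.ne', Real.rpow_neg (by norm_num), Real.rpow_intCast]
      field_simp
      ring
    rw [e1, e2] at h
    exact h.trans (HFSM.maximalBound_le_scaleBound hα0 hδ (by positivity) hρ.le (hScard j))
  obtain ⟨Ωstar, C, h1, h2, h3, h4, h5⟩ := HFSM.exists_random_bound (P := P)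
    (Z := fun j k ω => (ε j k ω).re) (fun j k => Complex.measurable_re.comp (hε j k).1) S
    (a := fun j => (1 + (j : ℝ)) ^ (1 / α + δ)) (fun j => by positivity)
    (HFSM.summable_scaleBound hα0 hα.2.le hδ ρ W) hprob
  exact ⟨Ωstar, C, h1, h2, h3, h4, fun ω hω j k hk => h5 ω hω j k (hS j k hk)⟩
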